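/- Let $A_0$ and $A$ be bounded self-adjoint operators in complex Hilbert spaces $\mathcal H_0$ and $\mathcal H$, let $J:\mathcal H_0\to\mathcal H$, $T:\mathcal H_0\to\mathcal H_0$ and $Q_0:\mathcal H_0\to\mathcal H_0$ be bounded operators with $AJ-JA_0=JT$, and let $\Delta\subset\mathbb R\setminus\{0\}$ be a bounded open interval. Write $R_0(z)=(A_0-z)^{-1}$, $R(z)=(A-z)^{-1}$, $Q=Q_0J^*$, and let $E_0$ be the spectral measure of $A_0$. Assume: (ii) $\operatorname{Ker}J\cap\operatorname{Ker}(A_0+T-z)=\{0\}$ for all complex $z\neq0$. (iii) $\operatorname{Ker}Q_0=\operatorname{Ker}Q_0^*=\{0\}$. (iv) The spectrum of $A_0$ on $\Delta$ is purely absolutely continuous with constant multiplicity, and $Q_0$ is strongly $A_0$-smooth on $\Delta$ with an exponent $\gamma\in(1/2,1)$; that is, there are a Hilbert space $\mathfrak h_0$ and a unitary map $F_0$ of $\operatorname{Ran}E_0(\Delta)$ onto $L^2(\Delta;\mathfrak h_0)$, extended by zero to $(\operatorname{Ran}E_0(\Delta))^\perp$, such that $(F_0A_0f)(\lambda)=\lambda(F_0f)(\lambda)$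 for $f\in\operatorname{Ran}E_0(\Delta)$ and a.e. $\lambda\in\Delta$, and such that each $F_0Q_0^*g$, $g\in\mathcal H_0$, has a representative satisfying, on every compact subinterval $\delta\subset\Delta$, $$\|(F_0Q_0^*g)(\lambda)\|\le C_\delta\|g\|,\qquad \|(F_0Q_0^*g)(\lambda)-(F_0Q_0^*g)(\mu)\|\le C_\delta|\lambda-\mu|^\gamma\|g\|,\qquad \lambda,\mu\in\delta,$$ with $C_\delta$ independent of $g$, $\lambda$, $\mu$. (v) $TA_0=Q_0^*KQ_0$ with a compact operator $K$ in $\mathcal H_0$. (vi) The operator $Q_0T^*Q_0^{-1}$, defined on the dense set $\operatorname{Ran}Q_0$, extends to a bounded operator $M_0$ on $\mathcal H_0$, and $M_0^2$ is compact. (vii) The operator $Q_0J^*JQ_0^{-1}$, defined on $\operatorname{Ran}Q_0$, extends to a bounded operator $M$ on $\mathcal H_0$. For $\operatorname{Im}z\ne0$ put $$G_0(z)=-z^{-1}M_0^*+z^{-1}KQ_0R_0(z)Q_0^*.$$ Then for every $\lambda\in\Delta$ the limits $G_0(\lambda\pm i0)$ of $G_0(z)$ as $z\to\lambda$, $\pm\operatorname{Im}z>0$,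 exist in the operator norm. Let $\mathcal N_\pm$ be the set of those $\lambda\in\Delta$ for which $g+G_0(\lambda\pm i0)g=0$ has a solution $g\neq0$. Then $\mathcal N_+$ and $\mathcal N_-$ are closed in $\Delta$ and have Lebesgue measure zero. Moreover, with $\mathcal N=\mathcal N_+\cap\mathcal N_-$, the operator-valued function $QR(z)Q^*$ is Hölder continuous with exponent $\gamma$ in the operator norm up to the cut along $\Delta$ away from $\mathcal N$: for each sign, it has an extension $B_\pm$ from $\{\pm\operatorname{Im}z>0\}$ to $\{\pm\operatorname{Im}z>0\}\cup(\Delta\setminus\mathcal N)$ such that for every compact set $\delta\subset\Delta\setminus\mathcal N$ there is a constant $C$ with $$\|B_\pm(z)-B_\pm(w)\|\le C|z-w|^\gamma\quad\text{whenever } \operatorname{Re}z,\operatorname{Re}w\in\delta,\ \pm\operatorname{Im}z\ge0,\ \pm\operatorname{Im}w\ge0.$$ -/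

import Mathlib

open MeasureTheory Filter Topology Set
open scoped CompactlySupported

noncomputable section

section SpectralMeasure

variable {H : Type*} [NormedAddCommGroup H] [InnerProductSpace ℂ H] [CompleteSpace H]

/-- The positive linear functional `φ ↦ ⟨f, φ(A) f⟩` on `C_c(ℝ)`, where `φ(A)` is given by the
continuous functional calculus of the bounded self-adjoint operator `A`. -/
def spectralFunctional (A : H →L[ℂ] H) (f : H) : C_c(ℝ, ℝ) →ₚ[ℝ] ℝ :=
  PositiveLinearMap.mk₀
    { toFun := fun φ => (inner ℂ f (cfc (fun x : ℝ => φ x) A f)).re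
      map_add' := fun φ ψ => by
        have h : cfc (fun x : ℝ => (φ + ψ) x) A
            = cfc (fun x : ℝ => φ x) A + cfc (fun x : ℝ => ψ x) A :=
          cfc_add A (fun x : ℝ => φ x) (fun x : ℝ => ψ x)
            φ.continuous.continuousOn ψ.continuous.continuousOn
        rw [h]
        simp
      map_smul' := fun c φ => by
        have h : cfc (fun x : ℝ => (c • φ) x) A = c • cfc (fun x : ℝ => φ x) A :=
          cfc_smul c (fun x : ℝ => φ x) A φ.continuous.continuousOn
        rw [h]
        simp [inner_smul_right_eq_smul] }
    (fun φ hφ => by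
      have h0 : (0 : H →L[ℂ] H) ≤ cfc (fun x : ℝ => φ x) A :=
        cfc_nonneg (fun x _ => hφ x)
      have h1 := ((ContinuousLinearMap.nonneg_iff_isPositive _).1 h0).re_inner_nonneg_right f
      simpa using h1)

/-- The scalar spectral measure `S ↦ (E(S) f, f)` of a bounded self-adjoint operator `A` at `f`:
the Riesz measure of `φ ↦ ⟨f, φ(A) f⟩`. -/
def spectralMeasure (A : H →L[ℂ] H) (f : H) : Measure ℝ :=
  RealRMK.rieszMeasure (spectralFunctional A f)

/-- `Ran E(S)`, where `E` is the projection-valued spectral measure of `A`. A vector `f` lies in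
`Ran E(S)` exactly when `‖E(Sᶜ) f‖² = (E(Sᶜ) f, f) = 0`; these vectors already form a closed
subspace when `A` is self-adjoint and `S` is Borel, so that taking the closed span adds nothing. -/
def spectralSubspace (A : H →L[ℂ] H) (S : Set ℝ) : Submodule ℂ H :=
  (Submodule.span ℂ {f : H | spectralMeasure A f Sᶜ = 0}).topologicalClosure

instance (A : H →L[ℂ] H) (S : Set ℝ) : CompleteSpace (spectralSubspace A S) :=
  (Submodule.isClosed_topologicalClosure _).completeSpace_coe

/-- A unitary map `F` of `Ran E(Δ)` onto `L²(Δ; h)` diagonalizes `A` if it takes `A` to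
multiplication by the independent variable: `(F A f)(x) = x (F f)(x)`. (`A f` lies in `Ran E(Δ)`
for `f ∈ Ran E(Δ)`, so the orthogonal projection in the formula does not change it.) The
existence of such an `F` says that the spectrum of `A` on `Δ` is purely absolutely continuous
with constant multiplicity `dim h`. -/
def Diagonalizes (A : H →L[ℂ] H) (Δ : Set ℝ)
    {h : Type*} [NormedAddCommGroup h] [InnerProductSpace ℂ h]
    (F : spectralSubspace A Δ ≃ₗᵢ[ℂ] Lp h 2 (volume.restrict Δ)) : Prop :=
  ∀ f : spectralSubspace A Δ,
    (F ((spectralSubspace A Δ).orthogonalProjectionOnto (A f)) : ℝ → h)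
      =ᵐ[volume.restrict Δ] fun x => (x : ℂ) • (F f : ℝ → h) x

/-- `Q : H → K` is strongly `A`-smooth on the interval `Δ` with exponent `γ`, with fibre space `h`:
for some unitary diagonalization `F` of `A` on `Ran E(Δ)` (extended by zero to the orthogonal
complement), `F Q^* g` is represented by a function `u g` on `Δ` with
`|u g (x)| ≤ C ‖g‖` and `|u g (x) - u g (y)| ≤ C |x - y| ^ γ ‖g‖`, where `C` is uniform in `g` and
in `x`, `y` from any given compact subinterval of `Δ`. -/
def StronglySmooth (h : Type*) [NormedAddCommGroup h] [InnerProductSpace ℂ h]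
    {K : Type*} [NormedAddCommGroup K] [InnerProductSpace ℂ K] [CompleteSpace K]
    (A : H →L[ℂ] H) (Q : H →L[ℂ] K) (Δ : Set ℝ) (γ : ℝ) : Prop :=
  ∃ F : spectralSubspace A Δ ≃ₗᵢ[ℂ] Lp h 2 (volume.restrict Δ),
    Diagonalizes A Δ F ∧
    ∃ u : K → ℝ → h,
      (∀ g : K,
        (F ((spectralSubspace A Δ).orthogonalProjectionOnto (ContinuousLinearMap.adjoint Q g)) : ℝ → h)
          =ᵐ[volume.restrict Δ] u g) ∧
      ∀ c d : ℝ, Icc c d ⊆ Δ → ∃ C : ℝ, ∀ g : K, ∀ x ∈ Icc c d, ∀ y ∈ Icc c d,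
        ‖u g x‖ ≤ C * ‖g‖ ∧ ‖u g x - u g y‖ ≤ C * |x - y| ^ γ * ‖g‖

end SpectralMeasure

section Resolvent

variable {H : Type*} [NormedAddCommGroup H] [InnerProductSpace ℂ H]

/-- The resolvent `(A - z)⁻¹`. -/
def resolventAt (A : H →L[ℂ] H) (z : ℂ) : H →L[ℂ] H :=
  Ring.inverse (A - z • ContinuousLinearMap.id ℂ H)

/-- `G₀(z) = - z⁻¹ M₀^* + z⁻¹ K Q₀ R₀(z) Q₀^*`, where `R₀(z) = (A₀ - z)⁻¹`. -/
def gZero [CompleteSpace H] (A₀ Q₀ K M₀ : H →L[ℂ] H) (z : ℂ) : H →L[ℂ] H :=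
  -(z⁻¹ • ContinuousLinearMap.adjoint M₀)
    + z⁻¹ • (K ∘L Q₀ ∘L resolventAt A₀ z ∘L ContinuousLinearMap.adjoint Q₀)

/-- The open upper (`s = 1`) or lower (`s = -1`) half-plane. -/
def halfPlane (s : ℤˣ) : Set ℂ := {z | 0 < ((s : ℤ) : ℝ) * z.im}

/-- `B` is the boundary value `G(x ± i0)`, the sign being `s`: the limit, in the operator norm, of
`G(z)` as `z` tends to `x` within the open half-plane. -/
def IsBoundaryValue (G : ℂ → H →L[ℂ] H) (s : ℤˣ) (x : ℝ) (B : H →L[ℂ] H) : Prop :=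
  Tendsto G (𝓝[halfPlane s] (x : ℂ)) (𝓝 B)

/-- The set of the points `x ∈ Δ` for which `g + G(x ± i0) g = 0` has a solution `g ≠ 0`. -/
def exceptionalSet (G : ℂ → H →L[ℂ] H) (Δ : Set ℝ) (s : ℤˣ) : Set ℝ :=
  {x ∈ Δ | ∃ B : H →L[ℂ] H, IsBoundaryValue G s x B ∧ ∃ g : H, g ≠ 0 ∧ g + B g = 0}

end Resolvent

end

/-! The proof rests on one factorisation. By (v) and (vi), `(A₀ + T - z) R₀(z) Q₀^* = Q₀^* (1 +
G₀(z))`, while `J (A₀ + T - z) = (A - z) J`. Hence `R(z) J Q₀^* (1 + G₀(z)) = J R₀(z) Q₀^*`, and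
multiplying by `Q₀ J^*` and using (vii) gives `Q R(z) Q^* (1 + G₀(z)) = M Q₀ R₀(z) Q₀^*`
(`sandwich_mul_one_add_gZero`). It remains to control `Q₀ R₀ Q₀^*` at the cut and to invert `1 +
G₀`.

Regularity. In the spectral representation the derivative `Q₀ R₀(z)² Q₀^*` is, near a point of `Δ`,
the integral of `(x - z)⁻²` against a Hölder function plus a bounded term, so it is `O(|Im
z|^(γ-1))`. The Hardy–Littlewood argument turns this into Hölder continuity up to the cut
(`StronglySmooth.holderNear`), which `G₀` inherits because `0 ∉ Δ`.

Invertibility. `G₀(z)²` is compact, so `1 + G₀` is invertible as soon as it is injective. Off the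
real axis a null vector `g` yields `f = R₀(z) Q₀^* g` with `J f = 0` and `(A₀ + T - z) f = 0`, and
(ii), (iii) force `g = 0`. Near a boundary value, singularity of `1 + X` is the vanishing of a `C¹`
scalar function `Φ` (`exists_determinant_of_isCompactOperator_sq`). Thus `Φ(G₀(z))` is holomorphic
and zero-free in a half-disc and tends to zero at the exceptional points; were these of positive
measure, it would have a zero inside (`exists_eq_zero_of_boundary_zeros`).

Only the intersection of `N₊` and `N₋` matters at the end because `(Q R(z) Q^*)^* = Q R(z̄) Q^*`:
Hölder continuity from one side of the cut is reflected to the other. -/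

/-! ### Operators with compact square: Fredholm alternative and a local determinant -/

section CompactOperators

variable {H : Type*} [NormedAddCommGroup H] [InnerProductSpace ℂ H]

theorem isCompactOperator_starProjection (V : Submodule ℂ H) [FiniteDimensional ℂ V] :
    IsCompactOperator (V.starProjection : H →L[ℂ] H) := by
  have h1 : IsCompactOperator (_root_.id : V → V) := 
    (isCompactOperator_id_iff_finiteDimensional (𝕜 := ℂ)).2 inferInstance
  have h2 := (h1.comp_clm V.orthogonalProjectionOnto).clm_comp V.subtypeL
  exact h2

/-- Take for `V` the span of a finite `ε`-net of the image of the unit ball: the projection onto `V`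
is at least as close to `C x` as the nearest point of the net. -/
theorem IsCompactOperator.exists_norm_sub_starProjection_mul_le {C : H →L[ℂ] H}
    (hC : IsCompactOperator C) {ε : ℝ} (hε : 0 < ε) :
    ∃ V : Submodule ℂ H, ∃ _ : FiniteDimensional ℂ V, ‖C - V.starProjection * C‖ ≤ ε := by
  obtain ⟨K, hK, hsub⟩ := hC.image_closedBall_subset_compact (f := (C : H →ₗ[ℂ] H)) 1
  obtain ⟨t, -, htf, ht⟩ := Metric.totallyBounded_iff.1 hK.totallyBounded ε hε |>.imp
    fun t h => And.intro trivial h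
  refine ⟨Submodule.span ℂ t, FiniteDimensional.span_of_finite ℂ htf, ?_⟩
  have := FiniteDimensional.span_of_finite ℂ htf
  refine ContinuousLinearMap.opNorm_le_of_unit_norm hε.le fun x hx => ?_
  have h1 : C x ∈ K := hsub ⟨x, by simp [hx], rfl⟩
  obtain ⟨y, hy, hxy⟩ := mem_iUnion₂.1 (ht h1)
  have h2 := Submodule.starProjection_minimal (U := Submodule.span ℂ t) (C x)
  have h3 : ‖C x - (Submodule.span ℂ t).starProjection (C x)‖ ≤ ‖C x - y‖ := by
    rw [h2]
    exact ciInf_le ⟨0, by rintro _ ⟨w, rfl⟩; exact norm_nonneg _⟩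
      (⟨y, Submodule.subset_span hy⟩ : Submodule.span ℂ t)
  refine h3.trans ?_
  rw [← dist_eq_norm]
  exact (Metric.mem_ball.1 hxy).le

variable [CompleteSpace H]

/-- The finite-rank operators `C^* P` approximate `C^*`, because `C^* - C^* P` is the adjoint of `C
- P C`. -/
theorem IsCompactOperator.adjoint_of_hilbert {C : H →L[ℂ] H} (hC : IsCompactOperator C) :
    IsCompactOperator (ContinuousLinearMap.adjoint C) := by
  have hcl : IsClosed {f : H →L[ℂ] H | IsCompactOperator f} := isClosed_setOfPred_isCompactOperator
  refine hcl.closure_subset (Metric.mem_closure_iff.2 fun ε hε => ?_)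
  obtain ⟨V, hV, h⟩ := hC.exists_norm_sub_starProjection_mul_le (half_pos hε)
  refine ⟨ContinuousLinearMap.adjoint C ∘L V.starProjection, ?_, ?_⟩
  · exact (isCompactOperator_starProjection V).clm_comp (ContinuousLinearMap.adjoint C)
  · rw [dist_eq_norm]
    have : ContinuousLinearMap.adjoint C - ContinuousLinearMap.adjoint C ∘L V.starProjection
        = star (C - V.starProjection * C) := by
      rw [star_sub, star_mul, (isSelfAdjoint_starProjection (𝕜 := ℂ) V).star_eq]
      rfl
    rw [this, norm_star]
    linarith

/-- All terms of the exponential series from `W²` on are compact, so `exp W` is `1 + W` modulo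
compacts, and `(1 + W)(1 - W) = 1 - W²`. -/
theorem isCompactOperator_exp_mul_one_sub_sub_one {W : H →L[ℂ] H} (hW : IsCompactOperator (W * W)) :
    IsCompactOperator (NormedSpace.exp W * (1 - W) - 1 : H →L[ℂ] H) := by
  have hcl : IsClosed {f : H →L[ℂ] H | IsCompactOperator f} := isClosed_setOfPred_isCompactOperator
  have hs := (NormedSpace.expSeries_summable' (𝕂 := ℂ) W).hasSum
  have h1 : NormedSpace.exp W = ∑' n : ℕ, ((n.factorial : ℂ))⁻¹ • W ^ n :=
    congrFun (NormedSpace.exp_eq_tsum ℂ) W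
  rw [← h1] at hs
  have h2 : HasSum (fun n => (((n + 2).factorial : ℂ))⁻¹ • W ^ (n + 2))
      (NormedSpace.exp W - ∑ i ∈ Finset.range 2, ((i.factorial : ℂ))⁻¹ • W ^ i) :=
    (hasSum_nat_add_iff' 2).2 hs
  have h3 : IsCompactOperator (NormedSpace.exp W - ∑ i ∈ Finset.range 2,
      ((i.factorial : ℂ))⁻¹ • W ^ i : H →L[ℂ] H) := by
    refine hcl.mem_of_tendsto h2 (Eventually.of_forall fun s => ?_)
    refine Submodule.sum_mem (compactOperator (RingHom.id ℂ) H H) fun i _ => ?_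
    refine IsCompactOperator.smul (f := (W ^ (i + 2) : H →L[ℂ] H)) ?_ _
    rw [pow_add, pow_two]
    exact hW.clm_comp _
  have h4 : NormedSpace.exp W * (1 - W) - 1 = (NormedSpace.exp W - ∑ i ∈ Finset.range 2,
      ((i.factorial : ℂ))⁻¹ • W ^ i) * (1 - W) - W * W := by
    simp [Finset.sum_range_succ]
    noncomm_ring
  rw [h4]
  exact IsCompactOperator.sub (h3.comp_clm (1 - W)) hW

/-- Near an operator with compact square, invertibility of `1 + X` is governed by a scalar
function: a determinant on a finite-dimensional space. -/
theorem exists_determinant_of_isCompactOperator_sq {X₀ : H →L[ℂ] H}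
    (hX₀ : IsCompactOperator (X₀ * X₀)) :
    ∃ Φ : (H →L[ℂ] H) → ℂ, ContDiffAt ℂ 1 Φ X₀ ∧ ∀ᶠ X in 𝓝 X₀,
      (Φ X ≠ 0 → IsUnit (1 + X)) ∧ (Φ X = 0 → ∃ g : H, g ≠ 0 ∧ g + X g = 0) := by
  let _ : NormedAlgebra ℚ (H →L[ℂ] H) := NormedAlgebra.restrictScalars ℚ ℂ _
  -- The factor `1 - X₀` would also make `1 + X₀` a compact perturbation of the identity, but it may
  -- be singular; `exp (-X₀)` is always invertible.
  obtain ⟨E, hE⟩ : IsUnit (NormedSpace.exp (-X₀)) := NormedSpace.isUnit_exp _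
  have hC₀ := isCompactOperator_exp_mul_one_sub_sub_one (W := -X₀) (by simpa using hX₀)
  rw [sub_neg_eq_add, ← hE] at hC₀
  set C₀ : H →L[ℂ] H := E * (1 + X₀) - 1 with hC₀d
  obtain ⟨V, hV, hVn⟩ := hC₀.exists_norm_sub_starProjection_mul_le (ε := 1 / 2) (by norm_num)
  set P : H →L[ℂ] H := V.starProjection with hP
  -- Removing the finite-rank part `P C₀` leaves at `X₀` the operator `1 + (C₀ - P C₀)`, invertible
  -- by a Neumann series; invertibility of `Y X` persists near `X₀`.
  let Y : (H →L[ℂ] H) → H →L[ℂ] H := fun X => E * (1 + X) - P * C₀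
  have hY₀ : IsUnit (Y X₀) := by
    have h1 : Y X₀ = 1 - (-(C₀ - P * C₀)) := by simp only [Y, hC₀d]; abel
    rw [h1]
    exact isUnit_one_sub_of_norm_lt_one (by rw [norm_neg]; linarith)
  have hYc : ContDiff ℂ 1 Y := by
    have : ContDiff ℂ 1 fun X : H →L[ℂ] H => (E : H →L[ℂ] H) * (1 + X) :=
      contDiff_const.mul (contDiff_const.add contDiff_id)
    exact this.sub contDiff_const
  let b := stdOrthonormalBasis ℂ V
  -- Since `E (1 + X) = (1 + P C₀ (Y X)⁻¹) Y X` and `P` maps into `V`, only the compression to `V`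
  -- decides invertibility.
  let D : (H →L[ℂ] H) → V →L[ℂ] V := fun X =>
    1 + V.orthogonalProjectionOnto ∘L C₀ ∘L Ring.inverse (Y X) ∘L V.subtypeL
  let Φ : (H →L[ℂ] H) → ℂ := fun X => Matrix.det (fun i j => inner ℂ (b i) (D X (b j)))
  have hΦ : ∀ X, Φ X = LinearMap.det (D X : V →ₗ[ℂ] V) := by
    intro X
    rw [← LinearMap.det_toMatrix b.toBasis]
    simp only [Φ]
    congr 1
    ext i j
    rw [LinearMap.toMatrix_apply]
    simp [OrthonormalBasis.repr_apply_apply]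
  refine ⟨Φ, ?_, ?_⟩
  · have hDc : ContDiffAt ℂ 1 D X₀ := by
      obtain ⟨u, hu⟩ := hY₀
      have h1 : ContDiffAt ℂ 1 (fun X => Ring.inverse (Y X)) X₀ := by
        refine ContDiffAt.comp X₀ (g := Ring.inverse) ?_ hYc.contDiffAt
        rw [← hu]
        exact contDiffAt_ringInverse ℂ u
      exact contDiffAt_const.add (contDiffAt_const.clm_comp (contDiffAt_const.clm_comp
        (h1.clm_comp contDiffAt_const)))
    have h2 : ∀ i j, ContDiffAt ℂ 1 (fun X => inner ℂ (b i) (D X (b j))) X₀ := fun i j =>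
      (innerSL ℂ (b i)).contDiff.contDiffAt.comp X₀ (hDc.clm_apply contDiffAt_const)
    have h3 : Φ = fun X => ∑ σ : Equiv.Perm (Fin (Module.finrank ℂ V)),
        Equiv.Perm.sign σ • ∏ i, inner ℂ (b (σ i)) (D X (b i)) := funext fun X => Matrix.det_apply _
    rw [h3]
    refine ContDiffAt.sum fun σ _ => ?_
    exact (contDiffAt_prod fun i _ => h2 _ _).const_smul (Equiv.Perm.sign σ : ℤ)
  · have hev : ∀ᶠ X in 𝓝 X₀, IsUnit (Y X) :=
      hYc.continuous.continuousAt.eventually (Units.isOpen.mem_nhds hY₀)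
    filter_upwards [hev] with X hX
    obtain ⟨u, hu⟩ := hX
    have hinv : Ring.inverse (Y X) = ↑u⁻¹ := by rw [← hu, Ring.inverse_unit]
    have hfac : (E : H →L[ℂ] H) * (1 + X) = (1 + P * C₀ * ↑u⁻¹) * u := by
      rw [add_mul, mul_assoc, Units.inv_mul, one_mul, mul_one, hu]
      simp [Y]
    have hDP : ∀ v : V, ((D X v : V) : H) = (v : H) + P (C₀ ((↑u⁻¹ : H →L[ℂ] H) v)) := by
      intro v
      simp [D, hinv, P]
    rw [hΦ]
    constructor
    · intro hdet
      have hDu : IsUnit (D X : V →ₗ[ℂ] V) :=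
        (LinearMap.isUnit_iff_isUnit_det _).2 (isUnit_iff_ne_zero.2 hdet)
      have hDb := (Module.End.isUnit_iff _).1 hDu
      have h1 : IsUnit (1 + P * C₀ * ↑u⁻¹ : H →L[ℂ] H) := by
        rw [ContinuousLinearMap.isUnit_iff_bijective]
        constructor
        · rw [injective_iff_map_eq_zero]
          intro x hx
          have hx' : x + P (C₀ ((↑u⁻¹ : H →L[ℂ] H) x)) = 0 := hx
          have hxV : x ∈ V := by
            rw [eq_neg_of_add_eq_zero_left hx']
            exact V.neg_mem (V.starProjection_apply_mem _)
          have h0 : (⟨x, hxV⟩ : V) = 0 := by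
            apply hDb.1
            rw [map_zero]
            apply Subtype.ext
            change ((D X ⟨x, hxV⟩ : V) : H) = _
            rw [hDP]
            exact hx'
          exact congrArg Subtype.val h0
        · intro y
          -- To solve `(1 + P C₀ u⁻¹) x = y`, put `x = y + v`: the unwanted term lies in `V` and is
          -- cancelled by a `v ∈ V`.
          obtain ⟨v, hv⟩ := hDb.2 (-V.orthogonalProjectionOnto (C₀ ((↑u⁻¹ : H →L[ℂ] H) y)))
          refine ⟨y + v, ?_⟩
          have hv' : ((D X v : V) : H) = -P (C₀ ((↑u⁻¹ : H →L[ℂ] H) y)) := congrArg Subtype.val hv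
          rw [hDP] at hv'
          change (y + v) + P (C₀ ((↑u⁻¹ : H →L[ℂ] H) (y + v))) = y
          rw [map_add, map_add, map_add]
          have : y + (v : H) + (P (C₀ ((↑u⁻¹ : H →L[ℂ] H) y)) + P (C₀ ((↑u⁻¹ : H →L[ℂ] H) v)))
            = y + ((v + P (C₀ ((↑u⁻¹ : H →L[ℂ] H) v))) + P (C₀ ((↑u⁻¹ : H →L[ℂ] H) y))) := by abel
          rw [this, hv']
          simp
      have h2 : IsUnit ((E : H →L[ℂ] H) * (1 + X)) := by
        rw [hfac]
        exact h1.mul u.isUnit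
      exact (Units.isUnit_units_mul E _).1 h2
    · intro hdet
      obtain ⟨v, hv, hv0⟩ := (Submodule.ne_bot_iff _).1
        (LinearMap.bot_lt_ker_of_det_eq_zero hdet).ne'
      have hv1 : D X v = 0 := hv
      have hv2 := hDP v
      rw [hv1] at hv2
      have hg : (u : H →L[ℂ] H) ((↑u⁻¹ : H →L[ℂ] H) v) = v := by
        rw [← mul_apply_eq_comp, Units.mul_inv]
        rfl
      refine ⟨(↑u⁻¹ : H →L[ℂ] H) v, ?_, ?_⟩
      · intro h0
        rw [h0, map_zero] at hg
        exact hv0 (Subtype.ext hg.symm)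
      · have h3 : ((E : H →L[ℂ] H) * (1 + X)) ((↑u⁻¹ : H →L[ℂ] H) v) = 0 := by
          rw [hfac, mul_apply_eq_comp, hg]
          exact hv2.symm
        have h4 := congrArg (↑E⁻¹ : H →L[ℂ] H) h3
        rw [← mul_apply_eq_comp, ← mul_assoc, Units.inv_mul, one_mul, map_zero] at h4
        exact h4

theorem isUnit_one_add_of_isCompactOperator_sq {X : H →L[ℂ] H} (hX : IsCompactOperator (X * X))
    (h : ∀ g : H, g + X g = 0 → g = 0) : IsUnit (1 + X) := by
  obtain ⟨Φ, -, hΦ⟩ := exists_determinant_of_isCompactOperator_sq hX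
  obtain ⟨h1, h2⟩ := hΦ.self_of_nhds
  refine h1 fun h0 => ?_
  obtain ⟨g, hg, hg'⟩ := h2 h0
  exact hg (h g hg')

end CompactOperators

/-! ### Local Hölder continuity up to the boundary of a half-plane -/

section HolderNear

variable {E E' : Type*} [NormedAddCommGroup E] [NormedAddCommGroup E']

/-- `F` is `γ`-Hölder continuous on the part of `D` near `x`. -/
def HolderNear (F : ℂ → E) (D : Set ℂ) (γ : ℝ) (x : ℂ) : Prop :=
  ∃ r > 0, ∃ C : ℝ, ∀ z ∈ D ∩ Metric.ball x r, ∀ w ∈ D ∩ Metric.ball x r,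
    ‖F z - F w‖ ≤ C * ‖z - w‖ ^ γ

theorem HolderNear.congr {F G : ℂ → E} {D : Set ℂ} {γ : ℝ} {x : ℂ} (hF : HolderNear F D γ x)
    (h : ∀ z ∈ D, G z = F z) : HolderNear G D γ x := by
  obtain ⟨r, hr, C, hC⟩ := hF
  refine ⟨r, hr, C, fun z hz w hw => ?_⟩
  rw [h z hz.1, h w hw.1]
  exact hC z hz w hw

theorem HolderNear.exists_tendsto [CompleteSpace E] {F : ℂ → E} {D : Set ℂ} {γ : ℝ} {x : ℂ}
    (hF : HolderNear F D γ x) (hγ : 0 < γ) [NeBot (𝓝[D] x)] :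
    ∃ B, Tendsto F (𝓝[D] x) (𝓝 B) := by
  obtain ⟨r, hr, C, hC⟩ := hF
  rw [← cauchy_map_iff_exists_tendsto, Metric.cauchy_iff]
  refine ⟨inferInstance, fun ε hε => ?_⟩
  have h1 : Tendsto (fun d : ℝ => |C| * d ^ γ) (𝓝 0) (𝓝 0) := by
    have h : Continuous fun d : ℝ => |C| * d ^ γ :=
      continuous_const.mul (continuous_id.rpow_const fun _ => Or.inr hγ.le)
    simpa [Real.zero_rpow hγ.ne'] using h.tendsto 0
  obtain ⟨δ, hδ, hδ'⟩ := Metric.eventually_nhds_iff.1 (h1.eventually (gt_mem_nhds hε))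
  refine ⟨F '' (D ∩ Metric.ball x (min r (δ / 2))), image_mem_map
    (inter_mem_nhdsWithin _ (Metric.ball_mem_nhds _ (by positivity))), ?_⟩
  rintro _ ⟨z, hz, rfl⟩ _ ⟨w, hw, rfl⟩
  have hz' : dist z x < min r (δ / 2) := hz.2
  have hw' : dist w x < min r (δ / 2) := hw.2
  have hd : ‖z - w‖ < δ := by
    rw [← dist_eq_norm]
    calc dist z w ≤ dist z x + dist w x := dist_triangle_right _ _ _
      _ < δ := by linarith [min_le_right r (δ / 2)]
  rw [dist_eq_norm]
  refine (hC z ⟨hz.1, hz'.trans_le (min_le_left _ _)⟩ w ⟨hw.1, hw'.trans_le (min_le_left _ _)⟩).trans_lt ?_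
  refine (mul_le_mul_of_nonneg_right (le_abs_self C) (by positivity)).trans_lt (hδ' ?_)
  simpa using hd

/-- A `C¹` map is Lipschitz near the limit `B`, and `F` stays in that neighbourhood close to `x`.
This carries Hölder bounds through inverses and determinants. -/
theorem HolderNear.comp_contDiffAt {𝕜 : Type*} [RCLike 𝕜] [NormedSpace 𝕜 E] [NormedSpace 𝕜 E']
    {F : ℂ → E} {D : Set ℂ} {γ : ℝ} {x : ℂ} {B : E} {Φ : E → E'}
    (hF : HolderNear F D γ x) (hB : Tendsto F (𝓝[D] x) (𝓝 B)) (hΦ : ContDiffAt 𝕜 1 Φ B) :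
    HolderNear (fun z => Φ (F z)) D γ x := by
  obtain ⟨r, hr, C, hC⟩ := hF
  obtain ⟨L, t, ht, hL⟩ := hΦ.exists_lipschitzOnWith
  obtain ⟨ρ, hρ, hρt⟩ := Metric.mem_nhdsWithin_iff.1 (hB ht)
  refine ⟨min r ρ, lt_min hr hρ, L * C, fun z hz w hw => ?_⟩
  have hz1 : F z ∈ t := hρt ⟨Metric.ball_subset_ball (min_le_right _ _) hz.2, hz.1⟩
  have hw1 : F w ∈ t := hρt ⟨Metric.ball_subset_ball (min_le_right _ _) hw.2, hw.1⟩
  have h1 := hL.dist_le_mul _ hz1 _ hw1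
  rw [dist_eq_norm, dist_eq_norm] at h1
  refine h1.trans ?_
  rw [mul_assoc]
  exact mul_le_mul_of_nonneg_left (hC z ⟨hz.1, Metric.ball_subset_ball (min_le_left _ _) hz.2⟩ w
    ⟨hw.1, Metric.ball_subset_ball (min_le_left _ _) hw.2⟩) L.2

theorem HolderNear.prodMk {F : ℂ → E} {G : ℂ → E'} {D : Set ℂ} {γ : ℝ} {x : ℂ}
    (hF : HolderNear F D γ x) (hG : HolderNear G D γ x) :
    HolderNear (fun z => (F z, G z)) D γ x := by
  obtain ⟨r, hr, C, hC⟩ := hF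
  obtain ⟨r', hr', C', hC'⟩ := hG
  refine ⟨min r r', lt_min hr hr', max C C', fun z hz w hw => ?_⟩
  have h1 := hC z ⟨hz.1, Metric.ball_subset_ball (min_le_left _ _) hz.2⟩ w
    ⟨hw.1, Metric.ball_subset_ball (min_le_left _ _) hw.2⟩
  have h2 := hC' z ⟨hz.1, Metric.ball_subset_ball (min_le_right _ _) hz.2⟩ w
    ⟨hw.1, Metric.ball_subset_ball (min_le_right _ _) hw.2⟩
  rw [Prod.mk_sub_mk, Prod.norm_mk]
  exact max_le (h1.trans (mul_le_mul_of_nonneg_right (le_max_left _ _) (by positivity)))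
    (h2.trans (mul_le_mul_of_nonneg_right (le_max_right _ _) (by positivity)))

theorem holderNear_of_lipschitz {F : ℂ → E} {D : Set ℂ} {γ : ℝ} {x : ℂ} (hγ' : γ ≤ 1)
    {r C : ℝ} (hr : 0 < r) (h : ∀ z ∈ D ∩ Metric.ball x r, ∀ w ∈ D ∩ Metric.ball x r,
      ‖F z - F w‖ ≤ C * ‖z - w‖) : HolderNear F D γ x := by
  -- Radius `1/2` keeps distances at most `1`, where `t ≤ t ^ γ`.
  refine ⟨min r (1 / 2), by positivity, |C|, fun z hz w hw => ?_⟩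
  have h1 := h z ⟨hz.1, Metric.ball_subset_ball (min_le_left _ _) hz.2⟩ w
    ⟨hw.1, Metric.ball_subset_ball (min_le_left _ _) hw.2⟩
  have hz' : dist z x < min r (1 / 2) := hz.2
  have hw' : dist w x < min r (1 / 2) := hw.2
  have hd : ‖z - w‖ ≤ 1 := by
    rw [← dist_eq_norm]
    calc dist z w ≤ dist z x + dist w x := dist_triangle_right _ _ _
      _ ≤ 1 := by linarith [min_le_right r (1 / 2)]
  rcases (norm_nonneg (z - w)).eq_or_lt with h0 | h0
  · rw [← h0] at h1
    refine h1.trans ?_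
    rw [mul_zero]
    positivity
  · refine h1.trans (mul_le_mul (le_abs_self C) ?_ h0.le (abs_nonneg _))
    calc ‖z - w‖ = ‖z - w‖ ^ (1 : ℝ) := (Real.rpow_one _).symm
      _ ≤ ‖z - w‖ ^ γ := Real.rpow_le_rpow_of_exponent_ge h0 hd hγ'

theorem norm_sub_le_of_tendsto_of_holder {F : ℂ → E} {D : Set ℂ} {γ : ℝ} (hγ : 0 < γ)
    {U : Set ℂ} (hU : IsOpen U) {C : ℝ}
    (hC : ∀ z ∈ D ∩ U, ∀ w ∈ D ∩ U, ‖F z - F w‖ ≤ C * ‖z - w‖ ^ γ)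
    {y y' : ℂ} {B B' : E} (hy : y ∈ U) (hy' : y' ∈ U) [NeBot (𝓝[D] y)] [NeBot (𝓝[D] y')]
    (hB : Tendsto F (𝓝[D] y) (𝓝 B)) (hB' : Tendsto F (𝓝[D] y') (𝓝 B')) :
    ‖B - B'‖ ≤ C * ‖y - y'‖ ^ γ := by
  have h1 : Tendsto (fun p : ℂ × ℂ => ‖F p.1 - F p.2‖) (𝓝[D] y ×ˢ 𝓝[D] y') (𝓝 ‖B - B'‖) :=
    ((hB.comp tendsto_fst).sub (hB'.comp tendsto_snd)).norm
  have hc : Continuous fun p : ℂ × ℂ => C * ‖p.1 - p.2‖ ^ γ :=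
    continuous_const.mul ((continuous_fst.sub continuous_snd).norm.rpow_const fun _ => Or.inr hγ.le)
  have h2 : Tendsto (fun p : ℂ × ℂ => C * ‖p.1 - p.2‖ ^ γ) (𝓝[D] y ×ˢ 𝓝[D] y')
      (𝓝 (C * ‖y - y'‖ ^ γ)) := by
    refine (hc.tendsto (y, y')).mono_left ?_
    rw [nhds_prod_eq]
    exact Filter.prod_mono inf_le_left inf_le_left
  refine le_of_tendsto_of_tendsto h1 h2 ?_
  have h3 : ∀ᶠ z in 𝓝[D] y, z ∈ D ∩ U := inter_mem self_mem_nhdsWithin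
    (mem_nhdsWithin_of_mem_nhds (hU.mem_nhds hy))
  have h4 : ∀ᶠ z in 𝓝[D] y', z ∈ D ∩ U := inter_mem self_mem_nhdsWithin
    (mem_nhdsWithin_of_mem_nhds (hU.mem_nhds hy'))
  filter_upwards [h3.prod_mk h4] with p hp
  exact hC _ hp.1 _ hp.2

theorem mem_halfPlane_conj {s : ℤˣ} {z : ℂ} (hz : z ∈ halfPlane s) : star z ∈ halfPlane (-s) := by
  simp only [halfPlane, mem_ofPred_eq] at hz ⊢
  simpa using hz

/-- Taking adjoints is isometric, and conjugation exchanges the half-planes while preserving discs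
about real points. -/
theorem HolderNear.star_conj [StarAddMonoid E] [NormedStarGroup E] {F G : ℂ → E} {s : ℤˣ} {γ : ℝ}
    {x : ℝ} (hF : HolderNear F (halfPlane s) γ x)
    (hG : ∀ z ∈ halfPlane (-s), G z = star (F (star z))) :
    HolderNear G (halfPlane (-s)) γ x := by
  obtain ⟨r, hr, C, hC⟩ := hF
  have hmem : ∀ z ∈ halfPlane (-s) ∩ Metric.ball (x : ℂ) r,
      star z ∈ halfPlane s ∩ Metric.ball (x : ℂ) r := by
    intro z hz
    refine ⟨by simpa using mem_halfPlane_conj hz.1, ?_⟩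
    have h1 : dist z x < r := hz.2
    have h2 : dist (star z) (x : ℂ) = dist z x := by
      rw [dist_eq_norm, dist_eq_norm, ← norm_star (z - x), star_sub]
      simp
    rwa [Metric.mem_ball, h2]
  refine ⟨r, hr, C, fun z hz w hw => ?_⟩
  rw [hG z hz.1, hG w hw.1, ← star_sub, norm_star]
  refine (hC _ (hmem z hz) _ (hmem w hw)).trans_eq ?_
  rw [← star_sub, norm_star]

theorem neBot_nhdsWithin_halfPlane {s : ℤˣ} {z : ℂ} (hz : 0 ≤ ((s : ℤ) : ℝ) * z.im) :
    NeBot (𝓝[halfPlane s] z) := by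
  rw [← mem_closure_iff_nhdsWithin_neBot, Metric.mem_closure_iff]
  intro ε hε
  have hs : ((s : ℤ) : ℝ) * ((s : ℤ) : ℝ) = 1 := by
    rcases Int.units_eq_one_or s with h | h <;> simp [h]
  refine ⟨z + ((ε / 2 * ((s : ℤ) : ℝ) : ℝ) : ℂ) * Complex.I, ?_, ?_⟩
  · simp only [halfPlane, mem_ofPred_eq]
    have : (z + ((ε / 2 * ((s : ℤ) : ℝ) : ℝ) : ℂ) * Complex.I).im = z.im + ε / 2 * ((s : ℤ) : ℝ) := by
      simp
    rw [this]
    nlinarith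
  · rw [dist_self_add_right, norm_mul, Complex.norm_I, mul_one, Complex.norm_real, Real.norm_eq_abs,
      abs_mul, abs_of_pos (half_pos hε)]
    have : |((s : ℤ) : ℝ)| = 1 := by
      rcases Int.units_eq_one_or s with h | h <;> simp [h]
    rw [this]
    linarith

end HolderNear

/-! ### The Hardy–Littlewood criterion for Hölder continuity -/

section HardyLittlewood

variable {E : Type*} [NormedAddCommGroup E] [NormedSpace ℂ E]

/-- Integrating the bound for the derivative gives `C / γ * ((y + d) ^ γ - y ^ γ)` with `y = Im z`,
and `t ↦ t ^ γ` is subadditive for `γ ≤ 1`. -/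
theorem norm_sub_vertical_le {F F' : ℂ → E} {γ C d : ℝ} {z : ℂ} (hγ : 0 < γ) (hγ' : γ ≤ 1)
    (hz : 0 < z.im) (hd : 0 ≤ d) (hC : 0 ≤ C)
    (hF : ∀ t ∈ Icc 0 d, HasDerivAt F (F' (z + t * Complex.I)) (z + t * Complex.I))
    (hb : ∀ t ∈ Icc 0 d, ‖F' (z + t * Complex.I)‖ ≤ C * (z.im + t) ^ (γ - 1)) :
    ‖F (z + d * Complex.I) - F z‖ ≤ C / γ * d ^ γ := by
  have hline : ∀ t : ℝ, HasDerivAt (fun t : ℝ => z + t * Complex.I) Complex.I t := fun t => by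
    simpa using (((Complex.ofRealCLM.hasDerivAt (x := t)).mul_const Complex.I).const_add z)
  have hder : ∀ t ∈ Icc 0 d, HasDerivAt (fun t : ℝ => F (z + t * Complex.I) - F z)
      (Complex.I • F' (z + t * Complex.I)) t := fun t ht =>
    ((hF t ht).scomp t (hline t)).sub_const _
  have hB : ∀ t ∈ Icc 0 d, HasDerivAt (fun t : ℝ => C / γ * ((z.im + t) ^ γ - z.im ^ γ))
      (C * (z.im + t) ^ (γ - 1)) t := fun t ht => by
    have h0 : z.im + t ≠ 0 := by linarith [ht.1]
    have h1 := ((((hasDerivAt_id t).const_add z.im).rpow_const (p := γ) (Or.inl h0)).sub_const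
      (z.im ^ γ)).const_mul (C / γ)
    have h2 : C * (z.im + t) ^ (γ - 1) = C / γ * (1 * γ * (z.im + t) ^ (γ - 1)) := by field_simp
    rw [h2]
    exact h1
  have h := image_norm_le_of_norm_deriv_right_le_deriv_boundary'
    (fun t ht => (hder t ht).continuousAt.continuousWithinAt)
    (fun t ht => (hder t (Ico_subset_Icc_self ht)).hasDerivWithinAt)
    (B := fun t => C / γ * ((z.im + t) ^ γ - z.im ^ γ)) (by simp)
    (fun t ht => (hB t ht).continuousAt.continuousWithinAt)
    (fun t ht => (hB t (Ico_subset_Icc_self ht)).hasDerivWithinAt)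
    (fun t ht => by
      rw [norm_smul, Complex.norm_I, one_mul]
      exact hb t (Ico_subset_Icc_self ht)) (right_mem_Icc.2 hd)
  refine h.trans (mul_le_mul_of_nonneg_left ?_ (by positivity))
  have := Real.rpow_add_le_add_rpow hz.le hd hγ.le hγ'
  linarith

/-- A function in the upper half-plane whose derivative is `O((Im z)^(γ-1))` near `x` is
`γ`-Hölder continuous near `x`. -/
theorem holderNear_of_norm_deriv_le {F F' : ℂ → E} {γ C r : ℝ} {x : ℝ} (hγ : 0 < γ) (hγ' : γ ≤ 1)
    (hr : 0 < r) (hC : 0 ≤ C)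
    (hF : ∀ z : ℂ, 0 < z.im → HasDerivAt F (F' z) z)
    (hb : ∀ z ∈ Metric.ball (x : ℂ) r, 0 < z.im → ‖F' z‖ ≤ C * z.im ^ (γ - 1)) :
    HolderNear F (halfPlane 1) γ x := by
  -- Join `z` to `w` by rising `d = ‖z - w‖`, crossing, and descending. The vertical legs cost `C /
  -- γ` each and the crossing `C`; as `d < 2r/3`, the path stays in the ball of radius `r`.
  refine ⟨r / 3, by positivity, C / γ + C + C / γ, fun z hz w hw => ?_⟩
  have hz0 : 0 < z.im := by simpa [halfPlane] using hz.1
  have hw0 : 0 < w.im := by simpa [halfPlane] using hw.1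
  have hz1 : dist z x < r / 3 := hz.2
  have hw1 : dist w x < r / 3 := hw.2
  set d := ‖z - w‖ with hd
  have hd0 : 0 ≤ d := norm_nonneg _
  have hdr : d < 2 * (r / 3) := by
    rw [hd, ← dist_eq_norm]
    linarith [dist_triangle_right z w (x : ℂ)]
  have hvert : ∀ v : ℂ, 0 < v.im → dist v x < r / 3 →
      ‖F (v + d * Complex.I) - F v‖ ≤ C / γ * d ^ γ := by
    intro v hv hvx
    refine norm_sub_vertical_le (F' := F') hγ hγ' hv hd0 hC (fun t ht => hF _ ?_) fun t ht => ?_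
    · simp; linarith [ht.1]
    · have h1 : (v + t * Complex.I).im = v.im + t := by simp
      rw [← h1]
      refine hb _ ?_ (by rw [h1]; linarith [ht.1])
      rw [Metric.mem_ball]
      have h2 : dist (v + t * Complex.I) v ≤ d := by
        rw [dist_self_add_left, norm_mul, Complex.norm_I, mul_one, Complex.norm_real,
          Real.norm_eq_abs, abs_of_nonneg ht.1]
        exact ht.2
      linarith [dist_triangle (v + t * Complex.I) v (x : ℂ)]
  have hhor : ‖F (z + d * Complex.I) - F (w + d * Complex.I)‖ ≤ C * d ^ γ := by
    rcases hd0.eq_or_lt with h0 | h0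
    · have : z = w := by rwa [← sub_eq_zero, ← norm_eq_zero, ← hd, eq_comm]
      rw [this, sub_self, norm_zero]
      positivity
    · have hconv : Convex ℝ {v : ℂ | d ≤ v.im} := convex_halfSpace_im_ge d
      let S : Set ℂ := {v : ℂ | d ≤ v.im} ∩ Metric.ball (x : ℂ) r
      have hS : Convex ℝ S := hconv.inter (convex_ball _ _)
      have hmem : ∀ v : ℂ, 0 < v.im → dist v x < r / 3 → v + d * Complex.I ∈ S := by
        intro v hv hvx
        refine ⟨by simp; exact hv.le, ?_⟩
        rw [Metric.mem_ball]
        have h2 : dist (v + d * Complex.I) v = d := by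
          rw [dist_self_add_left, norm_mul, Complex.norm_I, mul_one, Complex.norm_real,
            Real.norm_eq_abs, abs_of_nonneg hd0]
        linarith [dist_triangle (v + d * Complex.I) v (x : ℂ)]
      -- At height at least `d` the derivative is at most `C * d ^ (γ - 1)`, over a crossing of
      -- length `d`.
      have h := hS.norm_image_sub_le_of_norm_hasDerivWithin_le (C := C * d ^ (γ - 1))
        (fun v hv => (hF v (h0.trans_le hv.1)).hasDerivWithinAt)
        (fun v hv => (hb v hv.2 (h0.trans_le hv.1)).trans
          (mul_le_mul_of_nonneg_left
            (Real.rpow_le_rpow_of_nonpos h0 hv.1 (by linarith)) hC))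
        (hmem w hw0 hw1) (hmem z hz0 hz1)
      refine h.trans_eq ?_
      rw [add_sub_add_right_eq_sub, ← hd, mul_assoc, Real.rpow_sub_one h0.ne']
      field_simp
  have hsum : F z - F w = -(F (z + d * Complex.I) - F z) + (F (z + d * Complex.I) -
      F (w + d * Complex.I)) + (F (w + d * Complex.I) - F w) := by abel
  rw [hsum, add_mul, add_mul]
  refine (norm_add₃_le).trans ?_
  rw [norm_neg]
  exact add_le_add (add_le_add (hvert z hz0 hz1) hhor) (hvert w hw0 hw1)

end HardyLittlewood

/-! ### Poisson-type integrals and Cauchy transforms -/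

section PoissonKernel

theorem integrable_abs_rpow_div_one_add_sq {γ : ℝ} (hγ : 0 ≤ γ) (hγ' : γ < 1) :
    Integrable fun t : ℝ => |t| ^ γ / (1 + t ^ 2) := by
  have h1 : Integrable (fun t : ℝ => (1 + ‖t‖ ^ 2) ^ (-(2 - γ) / 2)) :=
    integrable_rpow_neg_one_add_norm_sq (by simp; linarith)
  refine h1.mono' ?_ (Eventually.of_forall fun t => ?_)
  · have h2 : Continuous fun t : ℝ => |t| ^ γ / (1 + t ^ 2) :=
      (continuous_abs.rpow_const fun _ => Or.inr hγ).div (by fun_prop) fun t => by positivity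
    exact h2.aestronglyMeasurable
  · have hp : 0 < 1 + t ^ 2 := by positivity
    rw [Real.norm_eq_abs, abs_of_nonneg (by positivity), Real.norm_eq_abs, sq_abs]
    have h3 : |t| ^ γ ≤ (1 + t ^ 2) ^ (γ / 2) := by
      rw [← Real.sqrt_sq_eq_abs, Real.sqrt_eq_rpow, ← Real.rpow_mul (by positivity)]
      rw [show 1 / 2 * γ = γ / 2 by ring]
      exact Real.rpow_le_rpow (by positivity) (by linarith) (by positivity)
    calc |t| ^ γ / (1 + t ^ 2) ≤ (1 + t ^ 2) ^ (γ / 2) / (1 + t ^ 2) := by gcongr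
      _ = (1 + t ^ 2) ^ (-(2 - γ) / 2) := by
        rw [show -(2 - γ) / 2 = γ / 2 - 1 by ring, Real.rpow_sub_one hp.ne']

theorem abs_rpow_div_eq_scaled {γ b : ℝ} (hb : 0 < b) (a t : ℝ) :
    |t - a| ^ γ / ((t - a) ^ 2 + b ^ 2)
      = b ^ (γ - 2) * (|b⁻¹ * (t - a)| ^ γ / (1 + (b⁻¹ * (t - a)) ^ 2)) := by
  rw [abs_mul, abs_of_pos (inv_pos.2 hb), Real.mul_rpow (by positivity) (abs_nonneg _),
    Real.inv_rpow hb.le, Real.rpow_sub hb, Real.rpow_two]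
  have h1 : (0 : ℝ) < b ^ γ := Real.rpow_pos_of_pos hb _
  have h2 : (t - a) ^ 2 + b ^ 2 ≠ 0 := by positivity
  have h3 : 1 + (b⁻¹ * (t - a)) ^ 2 ≠ 0 := by positivity
  have h4 : 1 + (b⁻¹ * (t - a)) ^ 2 = ((t - a) ^ 2 + b ^ 2) / b ^ 2 := by field_simp; ring
  rw [h4]
  field_simp

theorem integrable_abs_sub_rpow_div {γ b : ℝ} (hγ : 0 ≤ γ) (hγ' : γ < 1) (hb : 0 < b) (a : ℝ) :
    Integrable fun t : ℝ => |t - a| ^ γ / ((t - a) ^ 2 + b ^ 2) := by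
  simp_rw [abs_rpow_div_eq_scaled hb a]
  exact (((integrable_abs_rpow_div_one_add_sq hγ hγ').comp_mul_left' (inv_ne_zero hb.ne')).comp_sub_right
    a).const_mul _

/-- Substitute `t = a + b s`. Exponent `0` will bound the Poisson integral of a set; the Hölder
exponent will give the blow-up rate of the differentiated resolvent. -/
theorem integral_abs_sub_rpow_div {γ b : ℝ} (hb : 0 < b) (a : ℝ) :
    ∫ t : ℝ, |t - a| ^ γ / ((t - a) ^ 2 + b ^ 2)
      = b ^ (γ - 1) * ∫ t : ℝ, |t| ^ γ / (1 + t ^ 2) := by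
  simp_rw [abs_rpow_div_eq_scaled hb a]
  rw [integral_const_mul, integral_sub_right_eq_self
    (fun t : ℝ => |b⁻¹ * t| ^ γ / (1 + (b⁻¹ * t) ^ 2)) a,
    Measure.integral_comp_mul_left (fun t : ℝ => |t| ^ γ / (1 + t ^ 2)) b⁻¹, inv_inv, abs_of_pos hb,
    smul_eq_mul, ← mul_assoc]
  congr 1
  rw [← Real.rpow_add_one hb.ne']
  congr 1
  ring

theorem Complex.sq_norm_ofReal_sub (t : ℝ) (z : ℂ) :
    ‖(t : ℂ) - z‖ ^ 2 = (t - z.re) ^ 2 + z.im ^ 2 := by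
  rw [← Complex.normSq_eq_norm_sq, Complex.normSq_apply]
  simp
  ring

theorem Complex.abs_im_le_norm_ofReal_sub (t : ℝ) (z : ℂ) : |z.im| ≤ ‖(t : ℂ) - z‖ := by
  simpa using Complex.abs_im_le_norm ((t : ℂ) - z)

theorem Complex.ofReal_sub_ne_zero {z : ℂ} (hz : z.im ≠ 0) (t : ℝ) : (t : ℂ) - z ≠ 0 := by
  rw [← norm_pos_iff]
  exact (abs_pos.2 hz).trans_le (Complex.abs_im_le_norm_ofReal_sub t z)

theorem continuous_inv_ofReal_sub {z : ℂ} (hz : z.im ≠ 0) :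
    Continuous fun t : ℝ => ((t : ℂ) - z)⁻¹ :=
  (Complex.continuous_ofReal.sub continuous_const).inv₀ (Complex.ofReal_sub_ne_zero hz)

theorem integrable_inv_ofReal_sub {μ : Measure ℝ} [IsFiniteMeasure μ] {z : ℂ} (hz : z.im ≠ 0) :
    Integrable (fun t : ℝ => ((t : ℂ) - z)⁻¹) μ := by
  refine (integrable_const |z.im|⁻¹).mono' (continuous_inv_ofReal_sub hz).aestronglyMeasurable
    (Eventually.of_forall fun t => ?_)
  rw [norm_inv]
  exact inv_anti₀ (abs_pos.2 hz) (Complex.abs_im_le_norm_ofReal_sub t z)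

theorem differentiableAt_integral_inv_ofReal_sub {μ : Measure ℝ} [IsFiniteMeasure μ] {z : ℂ}
    (hz : z.im ≠ 0) : DifferentiableAt ℂ (fun z : ℂ => ∫ t : ℝ, ((t : ℂ) - z)⁻¹ ∂μ) z := by
  have hy : 0 < |z.im| := abs_pos.2 hz
  have him : ∀ w ∈ Metric.ball z (|z.im| / 2), |z.im| / 2 ≤ |w.im| := by
    intro w hw
    have h1 : |z.im - w.im| ≤ ‖w - z‖ := by
      rw [norm_sub_rev]
      simpa using Complex.abs_im_le_norm (z - w)
    have h2 : ‖w - z‖ < |z.im| / 2 := by simpa [dist_eq_norm] using hw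
    have h3 := abs_sub_abs_le_abs_sub z.im w.im
    linarith
  have h := hasDerivAt_integral_of_dominated_loc_of_deriv_le (μ := μ) (𝕜 := ℂ)
    (F := fun (w : ℂ) (t : ℝ) => ((t : ℂ) - w)⁻¹) (F' := fun (w : ℂ) (t : ℝ) => (((t : ℂ) - w) ^ 2)⁻¹)
    (x₀ := z) (bound := fun _ => ((|z.im| / 2) ^ 2)⁻¹)
    (Metric.ball_mem_nhds z (half_pos hy)) ?_ (integrable_inv_ofReal_sub hz) ?_ ?_
    (integrable_const _) ?_
  · exact h.2.differentiableAt
  · filter_upwards [Metric.ball_mem_nhds z (half_pos hy)] with w hw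
    refine (continuous_inv_ofReal_sub ?_).aestronglyMeasurable
    exact abs_pos.1 ((half_pos hy).trans_le (him w hw))
  · exact (((continuous_inv_ofReal_sub hz).pow 2).congr fun t => inv_pow _ _).aestronglyMeasurable
  · refine Eventually.of_forall fun t w hw => ?_
    rw [norm_inv, norm_pow]
    exact inv_anti₀ (by positivity)
      (pow_le_pow_left₀ (half_pos hy).le ((him w hw).trans (Complex.abs_im_le_norm_ofReal_sub t w)) 2)
  · refine Eventually.of_forall fun t w hw => ?_
    have h0 := Complex.ofReal_sub_ne_zero (abs_pos.1 ((half_pos hy).trans_le (him w hw))) t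
    have h1 := ((hasDerivAt_id w).const_sub (t : ℂ)).inv h0
    simp only [id, neg_neg, one_div] at h1
    exact h1

end PoissonKernel

/-! ### A boundary uniqueness theorem of Privalov type -/

section BoundaryUniqueness

/-- A bounded holomorphic function in a half-disc that tends to zero, uniformly, at the points of a
set of positive measure on the diameter has a zero. -/
theorem exists_eq_zero_of_boundary_zeros {s : ℤˣ} {f : ℂ → ℂ} {x₀ R M C γ : ℝ} (hR : 0 < R)
    (hγ : 0 < γ)
    (hf : DifferentiableOn ℂ f (halfPlane s ∩ Metric.ball (x₀ : ℂ) R))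
    (hM : ∀ z ∈ halfPlane s ∩ Metric.ball (x₀ : ℂ) R, ‖f z‖ ≤ M)
    {Z : Set ℝ} (hZm : MeasurableSet Z) (hZ : Z ⊆ Icc (x₀ - R / 8) (x₀ + R / 8))
    (hZ0 : volume Z ≠ 0)
    (hC : ∀ x ∈ Z, ∀ z ∈ halfPlane s ∩ Metric.ball (x₀ : ℂ) R, ‖f z‖ ≤ C * ‖z - x‖ ^ γ) :
    ∃ z ∈ halfPlane s ∩ Metric.ball (x₀ : ℂ) R, f z = 0 := by
  set σ : ℝ := ((s : ℤ) : ℝ) with hσ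
  have hσ2 : σ * σ = 1 := by rcases Int.units_eq_one_or s with h | h <;> simp [hσ, h]
  have hσa : |σ| = 1 := by rcases Int.units_eq_one_or s with h | h <;> simp [hσ, h]
  have hhp : ∀ z, z ∈ halfPlane s ↔ 0 < σ * z.im := fun z => Iff.rfl
  have hσi : ∀ z : ℂ, 0 < σ * z.im → |z.im| = σ * z.im := fun z hz => by
    rw [← abs_of_pos hz, abs_mul, hσa, one_mul]
  set r : ℝ := R / 2 with hr
  have hr0 : 0 < r := by positivity
  have hfin : volume Z < ⊤ := (measure_mono hZ).trans_lt measure_Icc_lt_top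
  have : IsFiniteMeasure (volume.restrict Z) := ⟨by simpa using hfin⟩
  set m : ℝ := (volume Z).toReal with hm
  have hm0 : 0 < m := ENNReal.toReal_pos hZ0 hfin.ne
  have hmr : volume.real Z = m := rfl
  -- the Poisson integral of `Z`
  let P : ℂ → ℂ := fun z => ∫ t in Z, ((t : ℂ) - z)⁻¹
  let q : ℂ → ℝ := fun z => σ * (P z).im
  have hq : ∀ z : ℂ, z.im ≠ 0 → q z = ∫ t in Z, σ * z.im / ‖(t : ℂ) - z‖ ^ 2 := by
    intro z hz
    have h1 : (P z).im = ∫ t in Z, (((t : ℂ) - z)⁻¹).im :=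
      ((Complex.imCLM.integral_comp_comm (integrable_inv_ofReal_sub hz)).symm)
    simp only [q]
    rw [h1, ← integral_const_mul]
    refine integral_congr_ae (Eventually.of_forall fun t => ?_)
    simp only [Complex.inv_im, Complex.sub_im, Complex.ofReal_im, zero_sub, neg_neg,
      Complex.normSq_eq_norm_sq]
    ring
  set κ : ℝ := ∫ t : ℝ, |t| ^ (0 : ℝ) / (1 + t ^ 2) with hκ
  have hker : ∀ z : ℂ, ∀ t : ℝ, σ * z.im / ‖(t : ℂ) - z‖ ^ 2
      = (σ * z.im) * (|t - z.re| ^ (0 : ℝ) / ((t - z.re) ^ 2 + |z.im| ^ 2)) := by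
    intro z t
    rw [Complex.sq_norm_ofReal_sub, Real.rpow_zero, sq_abs]
    ring
  have hint : ∀ z : ℂ, z.im ≠ 0 → Integrable fun t : ℝ => σ * z.im / ‖(t : ℂ) - z‖ ^ 2 := by
    intro z hz
    simp_rw [hker]
    exact (integrable_abs_sub_rpow_div le_rfl one_pos (abs_pos.2 hz) _).const_mul _
  have hqκ : ∀ z ∈ halfPlane s, q z ≤ κ := by
    intro z hz
    rw [hhp] at hz
    have hz0 : z.im ≠ 0 := fun h => by simp [h] at hz
    rw [hq z hz0]
    have h1 : ∫ t in Z, σ * z.im / ‖(t : ℂ) - z‖ ^ 2 ≤ ∫ t : ℝ, σ * z.im / ‖(t : ℂ) - z‖ ^ 2 :=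
      setIntegral_le_integral (hint z hz0) (Eventually.of_forall fun t => by positivity)
    refine h1.trans_eq ?_
    simp_rw [hker]
    rw [integral_const_mul, integral_abs_sub_rpow_div (abs_pos.2 hz0), ← hσi z hz, ← mul_assoc,
      zero_sub, Real.rpow_neg_one, mul_inv_cancel₀ (abs_pos.2 hz0).ne', one_mul]
  have hqub : ∀ z ∈ halfPlane s, ∀ d > 0, (∀ t ∈ Z, d ≤ ‖(t : ℂ) - z‖) →
      q z ≤ m * (σ * z.im / d ^ 2) := by
    intro z hz d hd hdt
    rw [hhp] at hz
    have hz0 : z.im ≠ 0 := fun h => by simp [h] at hz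
    rw [hq z hz0]
    have h1 : ∫ t in Z, σ * z.im / ‖(t : ℂ) - z‖ ^ 2 ≤ ∫ t in Z, σ * z.im / d ^ 2 := by
      refine setIntegral_mono_on (hint z hz0).integrableOn (integrable_const _) hZm fun t ht => ?_
      have := hdt t ht
      gcongr
    refine h1.trans_eq ?_
    simp [hmr]
  have hqlb : ∀ z ∈ halfPlane s, ∀ d > 0, (∀ t ∈ Z, ‖(t : ℂ) - z‖ ≤ d) →
      m * (σ * z.im / d ^ 2) ≤ q z := by
    intro z hz d hd hdt
    rw [hhp] at hz
    have hz0 : z.im ≠ 0 := fun h => by simp [h] at hz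
    rw [hq z hz0]
    have h1 : ∫ t in Z, σ * z.im / d ^ 2 ≤ ∫ t in Z, σ * z.im / ‖(t : ℂ) - z‖ ^ 2 := by
      refine setIntegral_mono_on (integrable_const _) (hint z hz0).integrableOn hZm fun t ht => ?_
      have := hdt t ht
      have h2 : 0 < ‖(t : ℂ) - z‖ := norm_pos_iff.2 (Complex.ofReal_sub_ne_zero hz0 t)
      gcongr
    refine le_trans (le_of_eq ?_) h1
    simp [hmr]
  -- With this `c`, `Re Θ = q - c |Im z|` is nonpositive on the arc of radius `r`, where `q ≤ (8/9)
  -- c |Im z|`, yet positive at height `r/4` above the centre, where `q ≥ m / r` and `c r / 4 = m /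
  -- (2 r)`.
  set c : ℝ := 2 * m / r ^ 2 with hc
  let Θ : ℂ → ℂ := fun z => Complex.I * σ * (c * z - P z)
  have hΘre : ∀ z, (Θ z).re = q z - c * (σ * z.im) := by
    intro z
    simp [Θ, q, Complex.mul_re, Complex.mul_im]
    ring
  have hP : ∀ z ∈ halfPlane s, DifferentiableAt ℂ P z := by
    intro z hz
    rw [hhp] at hz
    exact differentiableAt_integral_inv_ofReal_sub fun h => by simp [h] at hz
  have hΘ : ∀ z ∈ halfPlane s, DifferentiableAt ℂ Θ z := fun z hz =>
    ((differentiableAt_id.const_mul _).sub (hP z hz)).const_mul _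
  -- the point where `f` vanishes
  let z₁ : ℂ := x₀ + ((σ * (r / 4) : ℝ) : ℂ) * Complex.I
  have hz₁im : z₁.im = σ * (r / 4) := by simp [z₁]
  have hz₁re : z₁.re = x₀ := by simp [z₁]
  have hσz₁ : σ * z₁.im = r / 4 := by rw [hz₁im, ← mul_assoc, hσ2, one_mul]
  have hz₁h : z₁ ∈ halfPlane s := by rw [hhp, hσz₁]; positivity
  have hz₁n : ‖z₁ - x₀‖ = r / 4 := by
    simp only [z₁, add_sub_cancel_left]
    rw [norm_mul, Complex.norm_I, mul_one, Complex.norm_real, Real.norm_eq_abs, abs_mul, hσa,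
      one_mul, abs_of_pos (by positivity)]
  have hZr : ∀ t ∈ Z, |t - x₀| ≤ r / 4 := by
    intro t ht
    have := hZ ht
    rw [abs_le]
    constructor <;> linarith [this.1, this.2]
  have hv₁ : m / (2 * r) ≤ (Θ z₁).re := by
    rw [hΘre, hσz₁]
    have h1 := hqlb z₁ hz₁h (r / 2) (by positivity) fun t ht => by
      have h2 : ‖(t : ℂ) - z₁‖ ≤ ‖(t : ℂ) - x₀‖ + ‖z₁ - x₀‖ := by
        rw [norm_sub_rev z₁]
        exact norm_sub_le_norm_sub_add_norm_sub _ _ _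
      have h3 : ‖(t : ℂ) - x₀‖ = |t - x₀| := by
        rw [← Complex.ofReal_sub, Complex.norm_real, Real.norm_eq_abs]
      linarith [hZr t ht]
    rw [hσz₁] at h1
    have h2 : m * (r / 4 / (r / 2) ^ 2) - c * (r / 4) = m / (2 * r) := by
      rw [hc]; field_simp; norm_num
    linarith
  refine ⟨z₁, ⟨hz₁h, ?_⟩, ?_⟩
  · rw [Metric.mem_ball, dist_eq_norm, hz₁n]
    linarith
  -- the estimate
  have hM0 : 0 ≤ M := (norm_nonneg _).trans (hM z₁ ⟨hz₁h, by
    rw [Metric.mem_ball, dist_eq_norm, hz₁n]; linarith⟩)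
  -- Maximum principle for `f exp(Λ Θ)`, with a bound independent of `Λ`: letting `Λ` grow forces `f
  -- z₁ = 0`.
  have key : ∀ Λ : ℝ, 0 < Λ → ‖f z₁‖ * Real.exp (Λ * (Θ z₁).re) ≤ max 1 (M * Real.exp 1) := by
    intro Λ hΛ
    obtain ⟨δ, hδ, hδf⟩ : ∃ δ > 0, ∀ x ∈ Z, ∀ z ∈ halfPlane s ∩ Metric.ball (x₀ : ℂ) R,
        ‖z - x‖ < δ → ‖f z‖ ≤ Real.exp (-(Λ * κ)) := by
      have h1 : Tendsto (fun d : ℝ => C * d ^ γ) (𝓝 0) (𝓝 0) := by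
        have h : Continuous fun d : ℝ => C * d ^ γ :=
          continuous_const.mul (continuous_id.rpow_const fun _ => Or.inr hγ.le)
        simpa [Real.zero_rpow hγ.ne'] using h.tendsto 0
      obtain ⟨δ, hδ, hδ'⟩ := Metric.eventually_nhds_iff.1
        (h1.eventually (gt_mem_nhds (Real.exp_pos (-(Λ * κ)))))
      refine ⟨δ, hδ, fun x hx z hz hzx => (hC x hx z hz).trans (hδ' ?_).le⟩
      simpa using hzx
    -- The domain is cut off at height `ε`, so low that at points of this line at distance at least
    -- `δ` from `Z` the exponent is at most `1`. Closer to `Z`, the smallness `exp (-Λ κ)` of `f`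
    -- beats the largest possible exponential `exp (Λ κ)`.
    obtain ⟨ε, hε, hεr, hεδ⟩ : ∃ ε > 0, ε < r / 4 ∧ Λ * (m * (ε / δ ^ 2)) ≤ 1 := by
      refine ⟨min (r / 8) (δ ^ 2 / (Λ * m)), by positivity,
        (min_le_left _ _).trans_lt (by linarith), ?_⟩
      calc Λ * (m * (min (r / 8) (δ ^ 2 / (Λ * m)) / δ ^ 2))
          ≤ Λ * (m * ((δ ^ 2 / (Λ * m)) / δ ^ 2)) := by gcongr; exact min_le_right _ _
        _ = 1 := by field_simp
    let U : Set ℂ := Metric.ball (x₀ : ℂ) r ∩ {z | ε < σ * z.im}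
    have hUo : IsOpen U := Metric.isOpen_ball.inter
      (isOpen_lt continuous_const (continuous_const.mul Complex.continuous_im))
    have hUcl : closure U ⊆ Metric.closedBall (x₀ : ℂ) r ∩ {z | ε ≤ σ * z.im} :=
      closure_minimal (fun z hz => ⟨Metric.ball_subset_closedBall hz.1, le_of_lt (show ε < σ * z.im from hz.2)⟩)
        (Metric.isClosed_closedBall.inter
          (isClosed_le continuous_const (continuous_const.mul Complex.continuous_im)))
    have hUD : closure U ⊆ halfPlane s ∩ Metric.ball (x₀ : ℂ) R := fun z hz =>
      ⟨hε.trans_le (hUcl hz).2, Metric.closedBall_subset_ball (by linarith) (hUcl hz).1⟩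
    let g : ℂ → ℂ := fun z => f z * Complex.exp (Λ * Θ z)
    have hgn : ∀ z, ‖g z‖ = ‖f z‖ * Real.exp (Λ * (Θ z).re) := by
      intro z
      simp only [g]
      rw [norm_mul, Complex.norm_exp]
      simp
    have hg : DifferentiableOn ℂ g (closure U) := by
      refine DifferentiableOn.mono ?_ hUD
      refine hf.mul fun z hz => ?_
      exact ((hΘ z hz.1).const_mul (Λ : ℂ)).cexp.differentiableWithinAt
    have hmax := Complex.norm_le_of_forall_mem_frontier_norm_le (f := g) (U := U)
      (C := max 1 (M * Real.exp 1)) (Metric.isBounded_ball.subset inter_subset_left)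
      hg.diffContOnCl ?_ (z := z₁) (subset_closure ⟨?_, ?_⟩)
    · rwa [hgn] at hmax
    · intro z hz
      have hzc := hUcl (frontier_subset_closure hz)
      have hzD := hUD (frontier_subset_closure hz)
      have hzU : z ∉ U := by
        rw [frontier, hUo.interior_eq] at hz
        exact hz.2
      have hzc1 : ‖z - x₀‖ ≤ r := by simpa [dist_eq_norm] using hzc.1
      rw [hgn, hΘre]
      have hcy : 0 ≤ c * (σ * z.im) := mul_nonneg (by positivity) hzD.1.le
      by_cases harc : ‖z - x₀‖ = r
      · refine le_max_of_le_right ?_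
        refine mul_le_mul (hM z hzD) (Real.exp_le_exp.2 ?_) (Real.exp_pos _).le hM0
        refine le_trans ?_ zero_le_one
        refine mul_nonpos_of_nonneg_of_nonpos hΛ.le (sub_nonpos.2 ?_)
        refine (hqub z hzD.1 (3 * r / 4) (by positivity) fun t ht => ?_).trans ?_
        · have h3 : ‖(t : ℂ) - x₀‖ = |t - x₀| := by
            rw [← Complex.ofReal_sub, Complex.norm_real, Real.norm_eq_abs]
          have h2 : ‖z - x₀‖ ≤ ‖(t : ℂ) - z‖ + ‖(t : ℂ) - x₀‖ := by
            rw [norm_sub_rev (t : ℂ) z]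
            exact norm_sub_le_norm_sub_add_norm_sub _ _ _
          linarith [hZr t ht]
        · have : m * (σ * z.im / (3 * r / 4) ^ 2) = (8 / 9) * (c * (σ * z.im)) := by
            rw [hc]; field_simp; ring
          rw [this]
          linarith
      · have hline : σ * z.im = ε := by
          by_contra hne
          refine hzU ⟨?_, lt_of_le_of_ne hzc.2 (Ne.symm hne)⟩
          rw [Metric.mem_ball, dist_eq_norm]
          exact lt_of_le_of_ne hzc1 harc
        by_cases hnear : ∃ x ∈ Z, ‖z - x‖ < δ
        · obtain ⟨x, hx, hzx⟩ := hnear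
          refine le_max_of_le_left ?_
          calc ‖f z‖ * Real.exp (Λ * (q z - c * (σ * z.im)))
              ≤ Real.exp (-(Λ * κ)) * Real.exp (Λ * κ) := by
                refine mul_le_mul (hδf x hx z hzD hzx) (Real.exp_le_exp.2
                  (mul_le_mul_of_nonneg_left ?_ hΛ.le)) (Real.exp_pos _).le (Real.exp_pos _).le
                linarith [hqκ z hzD.1]
            _ = 1 := by rw [← Real.exp_add]; simp
        · push Not at hnear
          refine le_max_of_le_right ?_
          refine mul_le_mul (hM z hzD) (Real.exp_le_exp.2 ?_) (Real.exp_pos _).le hM0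
          have h1 := hqub z hzD.1 δ hδ fun t ht => by
            rw [norm_sub_rev]
            exact hnear t ht
          rw [hline] at h1
          refine le_trans (mul_le_mul_of_nonneg_left ?_ hΛ.le) hεδ
          linarith
    · rw [Metric.mem_ball, dist_eq_norm, hz₁n]
      linarith
    · change ε < σ * z₁.im
      rw [hσz₁]
      exact hεr
  have hv0 : 0 < (Θ z₁).re := lt_of_lt_of_le (by positivity) hv₁
  by_contra hne
  have hpos : 0 < ‖f z₁‖ := norm_pos_iff.2 hne
  set B := max 1 (M * Real.exp 1) with hB
  have hB0 : 0 < B := lt_of_lt_of_le one_pos (le_max_left _ _)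
  -- For this `Λ` the inequality `1 + t ≤ exp t` turns the bound into `B + ‖f z₁‖ ≤ B`.
  have h1 := key (B / (‖f z₁‖ * (Θ z₁).re)) (by positivity)
  have h2 : B / (‖f z₁‖ * (Θ z₁).re) * (Θ z₁).re = B / ‖f z₁‖ := by field_simp
  rw [h2] at h1
  have h3 := Real.add_one_le_exp (B / ‖f z₁‖)
  have h4 : ‖f z₁‖ * (B / ‖f z₁‖ + 1) ≤ B :=
    (mul_le_mul_of_nonneg_left h3 hpos.le).trans h1
  rw [mul_add, mul_div_cancel₀ _ hpos.ne'] at h4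
  linarith

end BoundaryUniqueness

/-! ### Spectral measures and spectral subspaces through the functional calculus -/

section SpectralSubspace

variable {H : Type*} [NormedAddCommGroup H] [InnerProductSpace ℂ H] [CompleteSpace H]

theorem cfc_eq_sq_cfc_sqrt (A : H →L[ℂ] H) {φ : ℝ → ℝ} (hφ : Continuous φ) (h0 : ∀ x, 0 ≤ φ x) :
    cfc φ A = cfc (fun x => √(φ x)) A * cfc (fun x => √(φ x)) A := by
  rw [← cfc_mul (fun x => √(φ x)) (fun x => √(φ x)) A hφ.sqrt.continuousOn hφ.sqrt.continuousOn]
  exact cfc_congr fun x _ => (Real.mul_self_sqrt (h0 x)).symm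

theorem inner_cfc_left (A : H →L[ℂ] H) (φ : ℝ → ℝ) (f g : H) :
    inner ℂ (cfc φ A f) g = inner ℂ f (cfc φ A g) := by
  have h : IsSelfAdjoint (cfc φ A) := cfc_predicate φ A
  conv_lhs => rw [← h.star_eq]
  exact ContinuousLinearMap.adjoint_inner_left _ _ _

theorem spectralFunctional_eq_norm_sq (A : H →L[ℂ] H) (f : H) {φ : C_c(ℝ, ℝ)} (h0 : ∀ x, 0 ≤ φ x) :
    spectralFunctional A f φ = ‖cfc (fun x => √(φ x)) A f‖ ^ 2 := by
  have h1 : spectralFunctional A f φ = (inner ℂ f (cfc (fun x : ℝ => φ x) A f)).re := rfl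
  have h2 : cfc (fun x : ℝ => φ x) A = _ := cfc_eq_sq_cfc_sqrt A φ.continuous h0
  rw [h1, h2, mul_apply_eq_comp, ← inner_cfc_left]
  exact (norm_sq_eq_re_inner (𝕜 := ℂ) _).symm

theorem commute_cfc (A : H →L[ℂ] H) (hA : IsSelfAdjoint A) (φ : ℝ → ℝ) : Commute (cfc φ A) A := by
  have h := cfc_commute_cfc φ id A
  rwa [cfc_id ℝ A] at h

theorem spectralFunctional_apply_le {A : H →L[ℂ] H} (hA : IsSelfAdjoint A) (f : H)
    {φ : C_c(ℝ, ℝ)} (h0 : ∀ x, 0 ≤ φ x) :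
    spectralFunctional A (A f) φ ≤ ‖A‖ ^ 2 * spectralFunctional A f φ := by
  rw [spectralFunctional_eq_norm_sq A _ h0, spectralFunctional_eq_norm_sq A _ h0, ← mul_pow]
  have h1 : cfc (fun x => √(φ x)) A (A f) = A (cfc (fun x => √(φ x)) A f) :=
    congrArg (fun B : H →L[ℂ] H => B f) (commute_cfc A hA _).eq
  rw [h1]
  exact pow_le_pow_left₀ (norm_nonneg _) (A.le_opNorm _) 2

theorem measure_eq_zero_of_isClosed_of_isCompact {μ : Measure ℝ} {S : Set ℝ} (hS : IsClosed S)
    (h : ∀ K : Set ℝ, IsCompact K → K ⊆ S → μ K = 0) : μ S = 0 := by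
  have h1 : S = ⋃ n : ℕ, S ∩ Metric.closedBall 0 n := by
    rw [← inter_iUnion, Metric.iUnion_closedBall_nat, inter_univ]
  rw [h1]
  exact measure_iUnion_null fun n =>
    h _ ((isCompact_closedBall _ _).inter_left hS) inter_subset_left

theorem exists_compactlySupported_one_zero {K S : Set ℝ} (hK : IsCompact K) (hS : IsClosed S)
    (hd : Disjoint K S) :
    ∃ φ : C_c(ℝ, ℝ), (∀ x ∈ K, φ x = 1) ∧ (∀ x ∈ S, φ x = 0) ∧ ∀ x, 0 ≤ φ x ∧ φ x ≤ 1 := by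
  obtain ⟨f, h1, h2, h3, h4⟩ := exists_continuous_one_zero_of_isCompact hK hS hd
  exact ⟨⟨f, h3⟩, h1, h2, h4⟩

/-- Functions of `A` commute with `A`, so on nonnegative test functions the functional at `A f` is
at most `‖A‖²` times the one at `f`. Outer regularity transfers this to null sets. -/
theorem spectralMeasure_apply_eq_zero {A : H →L[ℂ] H} (hA : IsSelfAdjoint A) {f : H} {S : Set ℝ}
    (hS : IsClosed S) (hf : spectralMeasure A f S = 0) : spectralMeasure A (A f) S = 0 := by
  refine measure_eq_zero_of_isClosed_of_isCompact hS fun K hK hKS => ?_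
  have : (spectralMeasure A f).Regular := RealRMK.regular_rieszMeasure _
  refine nonpos_iff_eq_zero.1 (ENNReal.le_of_forall_pos_le_add fun ε hε _ => ?_)
  rw [zero_add]
  -- The added `1` keeps the divisor positive when `A = 0`.
  set N : ℝ := ‖A‖ ^ 2 + 1 with hN
  have hN0 : 0 < N := by positivity
  obtain ⟨U, hKU, hU, hUε⟩ := Measure.OuterRegular.outerRegular hK.measurableSet
    (ENNReal.ofReal (ε / N))
    (by rw [measure_mono_null hKS hf]; exact ENNReal.ofReal_pos.2 (by positivity))
  obtain ⟨φ, h1, h2, h3⟩ := exists_compactlySupported_one_zero hK hU.isClosed_compl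
    (disjoint_compl_right_iff_subset.2 hKU)
  have h4 : spectralFunctional A f φ ≤ ε / N := by
    have h5 : ∫ x, φ x ∂(spectralMeasure A f) = spectralFunctional A f φ :=
      RealRMK.integral_rieszMeasure _ _
    have h6 : Integrable (fun x => φ x) (spectralMeasure A f) :=
      φ.continuous.integrable_of_hasCompactSupport φ.hasCompactSupport
    rw [← h5, ← ENNReal.ofReal_le_ofReal_iff (by positivity), ofReal_integral_eq_lintegral_ofReal h6
      (Eventually.of_forall fun x => (h3 x).1)]
    refine le_trans ?_ hUε.le
    rw [← lintegral_indicator_one hU.measurableSet]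
    refine lintegral_mono fun x => ?_
    by_cases hx : x ∈ U
    · simp [hx, (h3 x).2]
    · simp [hx, h2 x hx]
  calc spectralMeasure A (A f) K ≤ ENNReal.ofReal (spectralFunctional A (A f) φ) :=
        RealRMK.rieszMeasure_le_of_eq_one _ (fun x => (h3 x).1) hK h1
    _ ≤ ENNReal.ofReal ε := by
        refine ENNReal.ofReal_le_ofReal ?_
        refine (spectralFunctional_apply_le hA f fun x => (h3 x).1).trans ?_
        calc ‖A‖ ^ 2 * spectralFunctional A f φ ≤ ‖A‖ ^ 2 * (ε / N) := by gcongr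
          _ ≤ N * (ε / N) := by gcongr; linarith
          _ = ε := by field_simp
    _ = ε := by simp

theorem apply_mem_spectralSubspace {A : H →L[ℂ] H} (hA : IsSelfAdjoint A) {Δ : Set ℝ}
    (hΔ : IsOpen Δ) {v : H} (hv : v ∈ spectralSubspace A Δ) : A v ∈ spectralSubspace A Δ := by
  have h1 : spectralSubspace A Δ ≤ (spectralSubspace A Δ).comap (A : H →ₗ[ℂ] H) := by
    refine Submodule.topologicalClosure_minimal _ (Submodule.span_le.2 fun f hf => ?_) ?_
    · exact Submodule.le_topologicalClosure _ (Submodule.subset_span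
        (spectralMeasure_apply_eq_zero hA hΔ.isClosed_compl hf))
    · exact (Submodule.isClosed_topologicalClosure _).preimage A.continuous
  exact h1 hv

theorem cfc_apply_mem_spectralSubspace {A : H →L[ℂ] H} {Δ : Set ℝ}
    (hΔ : IsOpen Δ) {φ : ℝ → ℝ} (hφ : Continuous φ) (hsupp : tsupport φ ⊆ Δ) (f : H) :
    cfc φ A f ∈ spectralSubspace A Δ := by
  refine Submodule.le_topologicalClosure _ (Submodule.subset_span ?_)
  change spectralMeasure A (cfc φ A f) Δᶜ = 0
  refine measure_eq_zero_of_isClosed_of_isCompact hΔ.isClosed_compl fun K hK hKS => ?_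
  obtain ⟨ψ, h1, h2, h3⟩ := exists_compactlySupported_one_zero hK (isClosed_tsupport φ)
    (disjoint_left.2 fun x hx hx' => hKS hx (hsupp hx'))
  refine nonpos_iff_eq_zero.1 ((RealRMK.rieszMeasure_le_of_eq_one _ (fun x => (h3 x).1) hK h1).trans ?_)
  rw [spectralFunctional_eq_norm_sq A _ fun x => (h3 x).1, ← mul_apply_eq_comp,
    ← cfc_mul (fun x => √(ψ x)) φ A ψ.continuous.sqrt.continuousOn hφ.continuousOn]
  have h4 : cfc (fun x => √(ψ x) * φ x) A = 0 := by
    have h5 : (fun x => √(ψ x) * φ x) = fun _ => 0 := by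
      funext x
      by_cases hx : x ∈ tsupport φ
      · rw [h2 x hx, Real.sqrt_zero, zero_mul]
      · rw [image_eq_zero_of_notMem_tsupport hx, mul_zero]
    rw [h5]
    exact cfc_const_zero ℝ A
  rw [h4]
  simp

/-- The self-adjoint operator `φ(A)` has range in `Ran E(Δ)`, so it kills the orthogonal complement.
-/
theorem cfc_apply_starProjection_spectralSubspace {A : H →L[ℂ] H} {Δ : Set ℝ}
    (hΔ : IsOpen Δ) {φ : ℝ → ℝ} (hφ : Continuous φ) (hsupp : tsupport φ ⊆ Δ) (f : H) :
    cfc φ A ((spectralSubspace A Δ).starProjection f) = cfc φ A f := by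
  rw [eq_comm, ← sub_eq_zero, ← map_sub, ← inner_self_eq_zero (𝕜 := ℂ), inner_cfc_left,
    ← inner_cfc_left, ← inner_cfc_left]
  exact Submodule.inner_right_of_mem_orthogonal
    (cfc_apply_mem_spectralSubspace hΔ hφ hsupp _)
    (Submodule.sub_starProjection_mem_orthogonal f)

theorem commute_starProjection_of_invariant {A : H →L[ℂ] H} (hA : IsSelfAdjoint A)
    (V : Submodule ℂ H) [V.HasOrthogonalProjection] (hV : ∀ v ∈ V, A v ∈ V) (x : H) :
    V.starProjection (A x) = A (V.starProjection x) := by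
  refine (Submodule.eq_starProjection_of_mem_orthogonal (hV _ (V.starProjection_apply_mem x)) ?_)
  rw [← map_sub]
  intro v hv
  rw [← ContinuousLinearMap.adjoint_inner_left, ContinuousLinearMap.isSelfAdjoint_iff'.1 hA]
  exact Submodule.inner_right_of_mem_orthogonal (hV v hv)
    (Submodule.sub_starProjection_mem_orthogonal x)

end SpectralSubspace

/-! ### Resolvents of bounded self-adjoint operators -/

section Resolvent

variable {H : Type*} [NormedAddCommGroup H] [InnerProductSpace ℂ H] [CompleteSpace H]

theorem isUnit_sub_smul_id {A : H →L[ℂ] H} (hA : IsSelfAdjoint A) {z : ℂ} (hz : z.im ≠ 0) :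
    IsUnit (A - z • ContinuousLinearMap.id ℂ H) := by
  by_contra h
  refine hz (hA.im_eq_zero_of_mem_spectrum (z := z) ?_)
  rw [spectrum.mem_iff, ← IsUnit.neg_iff, neg_sub, Algebra.algebraMap_eq_smul_one]
  exact h

theorem sub_mul_resolventAt {A : H →L[ℂ] H} (hA : IsSelfAdjoint A) {z : ℂ} (hz : z.im ≠ 0) :
    (A - z • ContinuousLinearMap.id ℂ H) * resolventAt A z = 1 :=
  Ring.mul_inverse_cancel _ (isUnit_sub_smul_id hA hz)

theorem resolventAt_mul_sub {A : H →L[ℂ] H} (hA : IsSelfAdjoint A) {z : ℂ} (hz : z.im ≠ 0) :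
    resolventAt A z * (A - z • ContinuousLinearMap.id ℂ H) = 1 :=
  Ring.inverse_mul_cancel _ (isUnit_sub_smul_id hA hz)

theorem sub_resolventAt_apply {A : H →L[ℂ] H} (hA : IsSelfAdjoint A) {z : ℂ} (hz : z.im ≠ 0)
    (x : H) : A (resolventAt A z x) - z • resolventAt A z x = x := by
  simpa using congrArg (fun B : H →L[ℂ] H => B x) (sub_mul_resolventAt hA hz)

theorem resolventAt_sub_apply {A : H →L[ℂ] H} (hA : IsSelfAdjoint A) {z : ℂ} (hz : z.im ≠ 0)
    (x : H) : resolventAt A z (A x - z • x) = x := by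
  simpa using congrArg (fun B : H →L[ℂ] H => B x) (resolventAt_mul_sub hA hz)

theorem star_resolventAt {A : H →L[ℂ] H} (hA : IsSelfAdjoint A) (z : ℂ) :
    star (resolventAt A z) = resolventAt A (star z) := by
  have h1 : star (ContinuousLinearMap.id ℂ H) = ContinuousLinearMap.id ℂ H := star_one (H →L[ℂ] H)
  rw [resolventAt, resolventAt, ← Ring.inverse_star, star_sub, star_smul, hA.star_eq, h1]

/-- `⟨x, A x⟩` is real, so the imaginary part of `⟨x, (A - z) x⟩` is `-Im z ‖x‖²`; apply
Cauchy–Schwarz. -/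
theorem abs_im_mul_norm_le {A : H →L[ℂ] H} (hA : IsSelfAdjoint A) (z : ℂ) (x : H) :
    |z.im| * ‖x‖ ≤ ‖A x - z • x‖ := by
  rcases (norm_nonneg x).eq_or_lt with h0 | h0
  · rw [← h0, mul_zero]
    exact norm_nonneg _
  have h1 : (inner ℂ x (A x)).im = 0 := by
    have h2 : inner ℂ (A x) x = inner ℂ x (A x) := by
      conv_lhs => rw [← ContinuousLinearMap.isSelfAdjoint_iff'.1 hA]
      exact ContinuousLinearMap.adjoint_inner_left _ _ _
    rw [← inner_conj_symm] at h2
    exact Complex.conj_eq_iff_im.1 h2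
  have h3 : (inner ℂ x (A x - z • x)).im = -(z.im * ‖x‖ ^ 2) := by
    rw [inner_sub_right, inner_smul_right, inner_self_eq_norm_sq_to_K, Complex.sub_im, h1]
    simp [← Complex.ofReal_pow]
  have h4 : |z.im| * ‖x‖ ^ 2 ≤ ‖x‖ * ‖A x - z • x‖ := by
    calc |z.im| * ‖x‖ ^ 2 = |(inner ℂ x (A x - z • x)).im| := by
          rw [h3, abs_neg, abs_mul, abs_of_nonneg (by positivity : (0:ℝ) ≤ ‖x‖ ^ 2)]
      _ ≤ ‖inner ℂ x (A x - z • x)‖ := Complex.abs_im_le_norm _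
      _ ≤ ‖x‖ * ‖A x - z • x‖ := norm_inner_le_norm _ _
  nlinarith

theorem norm_resolventAt_le {A : H →L[ℂ] H} (hA : IsSelfAdjoint A) {z : ℂ} (hz : z.im ≠ 0) :
    ‖resolventAt A z‖ ≤ |z.im|⁻¹ := by
  refine ContinuousLinearMap.opNorm_le_bound _ (by positivity) fun x => ?_
  have h := abs_im_mul_norm_le hA z (resolventAt A z x)
  rw [sub_resolventAt_apply hA hz] at h
  rw [inv_mul_eq_div, le_div_iff₀ (abs_pos.2 hz), mul_comm]
  exact h

theorem resolventAt_sub_resolventAt {A : H →L[ℂ] H} (hA : IsSelfAdjoint A) {z w : ℂ}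
    (hz : z.im ≠ 0) (hw : w.im ≠ 0) :
    resolventAt A z - resolventAt A w = (z - w) • (resolventAt A z * resolventAt A w) := by
  have h1 : (z - w) • (1 : H →L[ℂ] H) = (A - w • ContinuousLinearMap.id ℂ H)
      - (A - z • ContinuousLinearMap.id ℂ H) := by
    rw [sub_smul, sub_sub_sub_cancel_left]
    rfl
  calc resolventAt A z - resolventAt A w
      = resolventAt A z * ((A - w • ContinuousLinearMap.id ℂ H)
      - (A - z • ContinuousLinearMap.id ℂ H)) * resolventAt A w := by
        rw [mul_sub, sub_mul, mul_assoc, sub_mul_resolventAt hA hw, resolventAt_mul_sub hA hz,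
          mul_one, one_mul]
    _ = _ := by
        rw [← h1, mul_smul_comm, smul_mul_assoc, mul_one]

theorem hasDerivAt_resolventAt {A : H →L[ℂ] H} (hA : IsSelfAdjoint A) {z : ℂ} (hz : z.im ≠ 0) :
    HasDerivAt (resolventAt A) (resolventAt A z * resolventAt A z) z := by
  obtain ⟨u, hu⟩ := isUnit_sub_smul_id hA hz
  have h1 : HasDerivAt (fun z : ℂ => A - z • ContinuousLinearMap.id ℂ H)
      (-((1 : ℂ) • ContinuousLinearMap.id ℂ H)) z :=
    ((hasDerivAt_id z).smul_const _).const_sub A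
  have h2 := hasFDerivAt_ringInverse (𝕜 := ℂ) u
  rw [hu] at h2
  have h3 := h2.comp_hasDerivAt z h1
  have h4 : (↑u⁻¹ : H →L[ℂ] H) = resolventAt A z := by
    rw [resolventAt, ← hu, Ring.inverse_unit]
  rw [h4] at h3
  have h5 : (-((ContinuousLinearMap.mulLeftRight ℂ (H →L[ℂ] H)) (resolventAt A z)) (resolventAt A z))
      (-((1 : ℂ) • ContinuousLinearMap.id ℂ H)) = resolventAt A z * resolventAt A z := by
    ext x
    simp
  rw [h5] at h3
  exact h3

/-- The projection onto `V` commutes with `A`, so the projection of `R(z) v` solves the same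
equation as `R(z) v`, and solutions are unique. -/
theorem resolventAt_mem_of_invariant {A : H →L[ℂ] H} (hA : IsSelfAdjoint A)
    (V : Submodule ℂ H) [V.HasOrthogonalProjection] (hV : ∀ v ∈ V, A v ∈ V) {z : ℂ} (hz : z.im ≠ 0)
    {v : H} (hv : v ∈ V) : resolventAt A z v ∈ V := by
  have h1 := sub_resolventAt_apply hA hz v
  have h2 := congrArg V.starProjection h1
  rw [map_sub, map_smul, commute_starProjection_of_invariant hA V hV,
    Submodule.starProjection_eq_self_iff.2 hv] at h2
  have h3 := congrArg (resolventAt A z) h2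
  rw [resolventAt_sub_apply hA hz] at h3
  exact Submodule.starProjection_eq_self_iff.1 h3

end Resolvent

/-! ### The functional calculus in the spectral representation -/

section Diagonalization

variable {H h : Type*} [NormedAddCommGroup H] [InnerProductSpace ℂ H] [CompleteSpace H]
  [NormedAddCommGroup h] [InnerProductSpace ℂ h]
  {A : H →L[ℂ] H} {Δ : Set ℝ} {F : spectralSubspace A Δ ≃ₗᵢ[ℂ] Lp h 2 (volume.restrict Δ)}

theorem Diagonalizes.map_apply (hF : Diagonalizes A Δ F) {v w : spectralSubspace A Δ}
    (hw : (w : H) = A v) :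
    (F w : ℝ → h) =ᵐ[volume.restrict Δ] fun x => (x : ℂ) • (F v : ℝ → h) x := by
  have h1 : (spectralSubspace A Δ).orthogonalProjectionOnto (A v) = w := by
    rw [← hw]
    exact Submodule.orthogonalProjectionOnto_mem_subspace_eq_self w
  have h2 := hF v
  rwa [h1] at h2

theorem Diagonalizes.map_resolventAt (hF : Diagonalizes A Δ F) (hA : IsSelfAdjoint A)
    (hΔ : IsOpen Δ) {z : ℂ} (hz : z.im ≠ 0) {v w : spectralSubspace A Δ}
    (hw : (w : H) = resolventAt A z v) :
    (F w : ℝ → h) =ᵐ[volume.restrict Δ] fun x => ((x : ℂ) - z)⁻¹ • (F v : ℝ → h) x := by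
  let w' : spectralSubspace A Δ := ⟨A w, apply_mem_spectralSubspace hA hΔ w.2⟩
  have h1 : v = w' - z • w := by
    apply Subtype.ext
    change (v : H) = A w - z • (w : H)
    rw [hw, sub_resolventAt_apply hA hz]
  have h2 := hF.map_apply (v := w) (w := w') rfl
  have h3 : (F v : ℝ → h) =ᵐ[volume.restrict Δ] fun x => (F w' : ℝ → h) x - z • (F w : ℝ → h) x := by
    rw [h1, map_sub, map_smul]
    filter_upwards [Lp.coeFn_sub (F w') (z • F w), Lp.coeFn_smul z (F w)] with x hx hx'
    rw [hx, Pi.sub_apply, hx', Pi.smul_apply]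
  filter_upwards [h2, h3] with x hx hx'
  rw [hx', hx, ← sub_smul, smul_smul, inv_mul_cancel₀ (Complex.ofReal_sub_ne_zero hz x), one_smul]

theorem Diagonalizes.inner_aeval_apply (hF : Diagonalizes A Δ F) (hA : IsSelfAdjoint A)
    (hΔ : IsOpen Δ) (hΔb : Bornology.IsBounded Δ) (p : Polynomial ℝ) (v w : spectralSubspace A Δ) :
    inner ℂ (w : H) (Polynomial.aeval A p v)
      = ∫ x in Δ, ((p.eval x : ℝ) : ℂ) * inner ℂ ((F w : ℝ → h) x) ((F v : ℝ → h) x) := by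
  have hint : ∀ p : Polynomial ℝ, Integrable (fun x : ℝ => ((p.eval x : ℝ) : ℂ) *
      inner ℂ ((F w : ℝ → h) x) ((F v : ℝ → h) x)) (volume.restrict Δ) := by
    intro p
    obtain ⟨B, hB⟩ := (hΔb.isCompact_closure.image p.continuous).isBounded.exists_norm_le
    refine (L2.integrable_inner (𝕜 := ℂ) (F w) (F v)).bdd_mul (c := B)
      (Complex.continuous_ofReal.comp p.continuous).aestronglyMeasurable ?_
    filter_upwards [ae_restrict_mem hΔ.measurableSet] with x hx
    rw [Complex.norm_real]
    exact hB _ ⟨x, subset_closure hx, rfl⟩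
  have hpow : ∀ n : ℕ, ∃ y : spectralSubspace A Δ, (y : H) = (A ^ n) v ∧
      (F y : ℝ → h) =ᵐ[volume.restrict Δ] fun x => ((x : ℂ) ^ n) • (F v : ℝ → h) x := by
    intro n
    induction n with
    | zero => exact ⟨v, by simp, by simp⟩
    | succ n ih =>
      obtain ⟨y, hy, hy'⟩ := ih
      refine ⟨⟨A y, apply_mem_spectralSubspace hA hΔ y.2⟩, ?_, ?_⟩
      · rw [pow_succ', mul_apply_eq_comp, ← hy]
      · filter_upwards [hF.map_apply (v := y) (w := ⟨A y, apply_mem_spectralSubspace hA hΔ y.2⟩) rfl,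
          hy'] with x hx hx'
        rw [hx, hx', smul_smul, pow_succ']
  induction p using Polynomial.induction_on' with
  | add p q hp hq =>
    rw [map_add, add_apply, inner_add_right, hp, hq, ← integral_add (hint p) (hint q)]
    refine integral_congr_ae (Eventually.of_forall fun x => ?_)
    simp only [Polynomial.eval_add, Complex.ofReal_add, add_mul]
  | monomial n c =>
    obtain ⟨y, hy, hy'⟩ := hpow n
    have h1 : (Polynomial.aeval A (Polynomial.monomial n c) : H →L[ℂ] H) v = (c : ℂ) • (y : H) := by
      rw [Polynomial.aeval_monomial, hy, mul_apply_eq_comp]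
      simp [Algebra.algebraMap_eq_smul_one]
    have h2 : inner ℂ (w : H) (y : H) = inner ℂ (F w) (F y) := (F.inner_map_map w y).symm
    rw [h1, inner_smul_right, h2, L2.inner_def, ← integral_const_mul]
    refine integral_congr_ae ?_
    filter_upwards [hy'] with x hx
    rw [hx, inner_smul_right, Polynomial.eval_monomial]
    push_cast
    ring

theorem Diagonalizes.inner_cfc_apply (hF : Diagonalizes A Δ F) (hA : IsSelfAdjoint A)
    (hΔ : IsOpen Δ) (hΔb : Bornology.IsBounded Δ) {φ : ℝ → ℝ} (hφ : Continuous φ)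
    (v w : spectralSubspace A Δ) :
    inner ℂ (w : H) (cfc φ A v)
      = ∫ x in Δ, (φ x : ℂ) * inner ℂ ((F w : ℝ → h) x) ((F v : ℝ → h) x) := by
  -- The interval `[-N, N]` contains both `Δ` and the spectrum of `A`, so a single Weierstrass
  -- polynomial approximates `φ` in the integral and in operator norm.
  obtain ⟨N, hN⟩ := (hΔb.union (Metric.isBounded_closedBall (x := (0 : ℝ)) (r := ‖A‖ * ‖(1 : H →L[ℂ] H)‖))).exists_norm_le
  have hint := L2.integrable_inner (𝕜 := ℂ) (F w) (F v)
  set k : ℝ → ℂ := fun x => inner ℂ ((F w : ℝ → h) x) ((F v : ℝ → h) x) with hk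
  have hmulint : ∀ ψ : ℝ → ℝ, Continuous ψ → Integrable (fun x => (ψ x : ℂ) * k x)
      (volume.restrict Δ) := by
    intro ψ hψ
    obtain ⟨B, hB⟩ := (hΔb.isCompact_closure.image hψ).isBounded.exists_norm_le
    refine hint.bdd_mul (c := B) (Complex.continuous_ofReal.comp hψ).aestronglyMeasurable ?_
    filter_upwards [ae_restrict_mem hΔ.measurableSet] with x hx
    rw [Complex.norm_real]
    exact hB _ ⟨x, subset_closure hx, rfl⟩
  rw [← sub_eq_zero, ← norm_le_zero_iff]
  set c : ℝ := ‖(w : H)‖ * ‖(v : H)‖ + ∫ x in Δ, ‖k x‖ with hc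
  have hc0 : 0 ≤ c := add_nonneg (by positivity) (integral_nonneg fun _ => norm_nonneg _)
  refine le_of_forall_pos_le_add fun ε hε => ?_
  rw [zero_add]
  obtain ⟨p, hp⟩ := exists_polynomial_near_of_continuousOn (-N) N φ hφ.continuousOn (ε / (c + 1))
    (by positivity)
  have hpN : ∀ x : ℝ, ‖x‖ ≤ N → |φ x - p.eval x| ≤ ε / (c + 1) := fun x hx => by
    rw [abs_sub_comm]
    exact (hp x (abs_le.1 hx)).le
  have h1 : ‖cfc φ A - Polynomial.aeval A p‖ ≤ ε / (c + 1) := by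
    rw [← cfc_polynomial p A hA, ← cfc_sub φ p.eval A hφ.continuousOn p.continuous.continuousOn]
    refine norm_cfc_le (by positivity) fun x hx => ?_
    refine hpN x (hN x (Or.inr ?_))
    rw [mem_closedBall_zero_iff]
    exact spectrum.norm_le_norm_mul_of_mem hx
  have h2 : inner ℂ (w : H) (cfc φ A v) - ∫ x in Δ, (φ x : ℂ) * k x
      = inner ℂ (w : H) ((cfc φ A - Polynomial.aeval A p : H →L[ℂ] H) v)
        - ∫ x in Δ, ((φ x - p.eval x : ℝ) : ℂ) * k x := by
    have h3 : ∫ x in Δ, ((φ x - p.eval x : ℝ) : ℂ) * k x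
        = (∫ x in Δ, (φ x : ℂ) * k x) - ∫ x in Δ, ((p.eval x : ℝ) : ℂ) * k x := by
      rw [← integral_sub (hmulint φ hφ) (hmulint _ p.continuous)]
      refine integral_congr_ae (Eventually.of_forall fun x => ?_)
      simp only [Complex.ofReal_sub, sub_mul]
    rw [h3, sub_apply, inner_sub_right, hF.inner_aeval_apply hA hΔ hΔb]
    ring
  rw [h2]
  calc _ ≤ ‖(w : H)‖ * (ε / (c + 1) * ‖(v : H)‖) + ε / (c + 1) * ∫ x in Δ, ‖k x‖ := by
        refine (norm_sub_le _ _).trans (add_le_add ?_ ?_)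
        · refine (norm_inner_le_norm _ _).trans (mul_le_mul_of_nonneg_left ?_ (norm_nonneg _))
          exact ContinuousLinearMap.le_of_opNorm_le _ h1 _
        · rw [← integral_const_mul]
          refine norm_integral_le_of_norm_le (hint.norm.const_mul _) ?_
          filter_upwards [ae_restrict_mem hΔ.measurableSet] with x hx
          rw [norm_mul, Complex.norm_real]
          exact mul_le_mul_of_nonneg_right (hpN x (hN x (Or.inl hx))) (norm_nonneg _)
    _ = ε * (c / (c + 1)) := by rw [hc]; ring
    _ ≤ ε * 1 := by
        refine mul_le_mul_of_nonneg_left ?_ hε.le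
        rw [div_le_one (by positivity)]
        linarith
    _ = ε := mul_one _

/-- The spectral representation of `⟨f, R(z)² φ(A) g⟩` for `φ` supported in `Δ`. -/
theorem Diagonalizes.inner_resolventAt_sq_cfc (hF : Diagonalizes A Δ F) (hA : IsSelfAdjoint A)
    (hΔ : IsOpen Δ) (hΔb : Bornology.IsBounded Δ) {φ : ℝ → ℝ} (hφ : Continuous φ)
    (hsupp : tsupport φ ⊆ Δ) {z : ℂ} (hz : z.im ≠ 0) (f g : H) :
    inner ℂ f ((resolventAt A z * resolventAt A z * cfc φ A) g)
      = ∫ x in Δ, (((x : ℂ) - z) ^ 2)⁻¹ * ((φ x : ℂ) *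
        inner ℂ ((F ((spectralSubspace A Δ).orthogonalProjectionOnto f) : ℝ → h) x)
          ((F ((spectralSubspace A Δ).orthogonalProjectionOnto g) : ℝ → h) x)) := by
  let V := spectralSubspace A Δ
  have hinv : ∀ v ∈ V, A v ∈ V := fun v hv => apply_mem_spectralSubspace hA hΔ hv
  have hz' : (star z).im ≠ 0 := by simpa using hz
  have hres : ∀ v ∈ V, resolventAt A (star z) v ∈ V := fun v hv =>
    resolventAt_mem_of_invariant hA V hinv hz' hv
  let v := V.orthogonalProjectionOnto g
  let u := V.orthogonalProjectionOnto f
  -- Both resolvents are moved to the left vector, where they become `R(z̄)²`; conjugate linearity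
  -- of the inner product there restores `(x - z)⁻²`.
  let w₁ : V := ⟨_, hres u u.2⟩
  let w : V := ⟨_, hres w₁ w₁.2⟩
  have hadj : ∀ x y : H, inner ℂ x (resolventAt A z y) = inner ℂ (resolventAt A (star z) x) y := by
    intro x y
    rw [← star_resolventAt hA]
    exact (ContinuousLinearMap.adjoint_inner_left _ _ _).symm
  have hmem : resolventAt A z (resolventAt A z (cfc φ A g)) ∈ V :=
    resolventAt_mem_of_invariant hA V hinv hz (resolventAt_mem_of_invariant hA V hinv hz
      (cfc_apply_mem_spectralSubspace hΔ hφ hsupp g))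
  have h1 : inner ℂ f ((resolventAt A z * resolventAt A z * cfc φ A) g)
      = inner ℂ (w : H) (cfc φ A v) := by
    calc inner ℂ f ((resolventAt A z * resolventAt A z * cfc φ A) g)
        = inner ℂ (u : H) (resolventAt A z (resolventAt A z (cfc φ A g))) := by
          rw [mul_apply_eq_comp, mul_apply_eq_comp, ← sub_eq_zero, ← inner_sub_left]
          exact Submodule.inner_left_of_mem_orthogonal hmem
            (Submodule.sub_starProjection_mem_orthogonal f)
      _ = _ := by
          rw [hadj, hadj, ← cfc_apply_starProjection_spectralSubspace hΔ hφ hsupp]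
          rfl
  rw [h1, hF.inner_cfc_apply hA hΔ hΔb hφ]
  refine integral_congr_ae ?_
  filter_upwards [hF.map_resolventAt hA hΔ hz' (v := u) (w := w₁) rfl,
    hF.map_resolventAt hA hΔ hz' (v := w₁) (w := w) rfl] with x hx hx'
  rw [hx', hx, inner_smul_left, inner_smul_left]
  simp only [map_inv₀, map_sub, Complex.conj_ofReal, Complex.star_def, Complex.conj_conj]
  change _ = (((x : ℂ) - z) ^ 2)⁻¹ * ((φ x : ℂ) * inner ℂ ((F u : ℝ → h) x) ((F v : ℝ → h) x))
  rw [pow_two, mul_inv]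
  ring

end Diagonalization

/-! ### Strong smoothness gives Hölder boundary values of the free resolvent -/

section SmoothResolvent

/-- The kernel `(x - z)⁻²` has integral zero, so `ψ (Re z)` may be subtracted from `ψ`; what remains
is at most `L |x - Re z| ^ γ / |x - z|²`, and scaling gives its integral. -/
theorem norm_integral_inv_sq_mul_le {γ L : ℝ} (hγ : 0 ≤ γ) (hγ' : γ < 1) {ψ : ℝ → ℂ}
    (hψ : ∀ x y, ‖ψ x - ψ y‖ ≤ L * |x - y| ^ γ) {z : ℂ} (hz : z.im ≠ 0) :
    ‖∫ x : ℝ, (((x : ℂ) - z) ^ 2)⁻¹ * ψ x‖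
      ≤ L * (|z.im| ^ (γ - 1) * ∫ t : ℝ, |t| ^ γ / (1 + t ^ 2)) := by
  have hb : 0 < |z.im| := abs_pos.2 hz
  have hnorm : ∀ x : ℝ, ‖(((x : ℂ) - z) ^ 2)⁻¹‖ = |x - z.re| ^ (0 : ℝ) / ((x - z.re) ^ 2 + |z.im| ^ 2) := by
    intro x
    rw [norm_inv, norm_pow, Complex.sq_norm_ofReal_sub, Real.rpow_zero, sq_abs, one_div]
  have hcont : Continuous fun x : ℝ => (((x : ℂ) - z) ^ 2)⁻¹ :=
    ((continuous_inv_ofReal_sub hz).pow 2).congr fun t => inv_pow _ _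
  have hint0 : Integrable fun x : ℝ => (((x : ℂ) - z) ^ 2)⁻¹ := by
    refine (integrable_abs_sub_rpow_div le_rfl one_pos hb z.re).mono' hcont.aestronglyMeasurable
      (Eventually.of_forall fun x => (hnorm x).le)
  have hzero : ∫ x : ℝ, (((x : ℂ) - z) ^ 2)⁻¹ = 0 := by
    have hder : ∀ x : ℝ, HasDerivAt (fun x : ℝ => -((x : ℂ) - z)⁻¹) (((x : ℂ) - z) ^ 2)⁻¹ x := by
      intro x
      have h1 := ((((Complex.ofRealCLM.hasDerivAt (x := x)).sub_const z)).inv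
        (Complex.ofReal_sub_ne_zero hz x)).neg
      simp only [Complex.ofRealCLM_apply, Complex.ofReal_one, neg_div, neg_neg, one_div] at h1
      exact h1
    have hlim : Tendsto (fun x : ℝ => -((x : ℂ) - z)⁻¹) (cocompact ℝ) (𝓝 0) := by
      rw [← neg_zero]
      refine Tendsto.neg ?_
      refine tendsto_inv₀_cobounded.comp ?_
      have h1 : Tendsto (fun x : ℝ => (x : ℂ)) (cocompact ℝ) (Bornology.cobounded ℂ) := by
        rw [← tendsto_norm_atTop_iff_cobounded]
        simp_rw [Complex.norm_real]
        exact tendsto_norm_cocompact_atTop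
      rw [← tendsto_norm_atTop_iff_cobounded] at h1 ⊢
      refine tendsto_atTop_mono (fun x => norm_sub_norm_le (x : ℂ) z) ?_
      exact tendsto_atTop_add_const_right _ _ h1
    have h2 := integral_of_hasDerivAt_of_tendsto hder hint0 (hlim.mono_left atBot_le_cocompact)
      (hlim.mono_left atTop_le_cocompact)
    simpa using h2
  have hbound : Integrable fun x : ℝ => L * (|x - z.re| ^ γ / ((x - z.re) ^ 2 + |z.im| ^ 2)) :=
    (integrable_abs_sub_rpow_div hγ hγ' hb z.re).const_mul L
  by_cases hi : Integrable fun x : ℝ => (((x : ℂ) - z) ^ 2)⁻¹ * ψ x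
  · have h1 : ∫ x : ℝ, (((x : ℂ) - z) ^ 2)⁻¹ * ψ x
        = ∫ x : ℝ, (((x : ℂ) - z) ^ 2)⁻¹ * (ψ x - ψ z.re) := by
      simp_rw [mul_sub]
      rw [integral_sub hi (hint0.mul_const _), integral_mul_const, hzero, zero_mul, sub_zero]
    rw [h1, ← integral_abs_sub_rpow_div hb z.re, ← integral_const_mul]
    refine norm_integral_le_of_norm_le hbound (Eventually.of_forall fun x => ?_)
    rw [norm_mul, hnorm, Real.rpow_zero]
    calc 1 / ((x - z.re) ^ 2 + |z.im| ^ 2) * ‖ψ x - ψ z.re‖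
        ≤ 1 / ((x - z.re) ^ 2 + |z.im| ^ 2) * (L * |x - z.re| ^ γ) := by
          gcongr
          exact hψ _ _
      _ = _ := by ring
  -- A non-integrable product has integral `0` by convention, so only nonnegativity of the right
  -- side is needed.
  · rw [integral_undef hi, norm_zero]
    have hL : 0 ≤ L := by
      have := (norm_nonneg _).trans (hψ 1 0)
      simpa using this
    have : 0 ≤ ∫ t : ℝ, |t| ^ γ / (1 + t ^ 2) := integral_nonneg fun t => by positivity
    positivity

end SmoothResolvent

section SmoothResolvent

variable {H : Type*} [NormedAddCommGroup H] [InnerProductSpace ℂ H]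

theorem opNorm_le_of_norm_inner_le {T : H →L[ℂ] H} {C : ℝ} (hC : 0 ≤ C)
    (h : ∀ f g, ‖inner ℂ f (T g)‖ ≤ C * ‖f‖ * ‖g‖) : ‖T‖ ≤ C := by
  refine T.opNorm_le_bound hC fun g => ?_
  rcases (norm_nonneg (T g)).eq_or_lt with h0 | h0
  · rw [← h0]
    positivity
  · have h1 := h (T g) g
    rw [inner_self_eq_norm_sq_to_K, norm_pow, RCLike.norm_ofReal, abs_norm] at h1
    nlinarith

variable [CompleteSpace H]

/-- Writing `w.re` for `w` changes nothing on the real spectrum and makes the function continuous on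
the whole plane. -/
theorem resolventAt_eq_cfc {A : H →L[ℂ] H} (hA : IsSelfAdjoint A) {z : ℂ} (hz : z.im ≠ 0) :
    resolventAt A z = cfc (fun w : ℂ => ((w.re : ℂ) - z)⁻¹) A := by
  have := hA.isStarNormal
  have hc : Continuous fun w : ℂ => ((w.re : ℂ) - z)⁻¹ :=
    (continuous_inv_ofReal_sub hz).comp Complex.continuous_re
  have h1 : (A - z • ContinuousLinearMap.id ℂ H) = cfc (fun w : ℂ => w - z) A := by
    rw [cfc_sub (fun w : ℂ => w) (fun _ => z) A, cfc_id' ℂ A, cfc_const z A,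
      Algebra.algebraMap_eq_smul_one]
    rfl
  have h2 : (A - z • ContinuousLinearMap.id ℂ H) * cfc (fun w : ℂ => ((w.re : ℂ) - z)⁻¹) A = 1 := by
    rw [h1, ← cfc_mul (fun w : ℂ => w - z) (fun w : ℂ => ((w.re : ℂ) - z)⁻¹) A
      (by fun_prop) hc.continuousOn, ← cfc_const_one ℂ A]
    refine cfc_congr fun w hw => ?_
    have hw' : (w.re : ℂ) = w := (hA.mem_spectrum_eq_re hw).symm
    have h0 := Complex.ofReal_sub_ne_zero hz w.re
    simp only [hw'] at h0 ⊢
    exact mul_inv_cancel₀ h0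
  calc resolventAt A z = resolventAt A z * ((A - z • ContinuousLinearMap.id ℂ H) *
        cfc (fun w : ℂ => ((w.re : ℂ) - z)⁻¹) A) := by rw [h2, mul_one]
    _ = _ := by rw [← mul_assoc, resolventAt_mul_sub hA hz, one_mul]

theorem norm_resolventAt_sq_mul_one_sub_cfc_le {A : H →L[ℂ] H} (hA : IsSelfAdjoint A) {z : ℂ}
    (hz : z.im ≠ 0) {φ : ℝ → ℝ} (hφ : Continuous φ) (hφ01 : ∀ x, 0 ≤ φ x ∧ φ x ≤ 1) {d : ℝ}
    (hd : 0 < d) (h : ∀ x : ℝ, φ x ≠ 1 → d ≤ ‖(x : ℂ) - z‖) :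
    ‖resolventAt A z * resolventAt A z * (1 - cfc φ A)‖ ≤ (d ^ 2)⁻¹ := by
  have := hA.isStarNormal
  have hc : Continuous fun w : ℂ => ((w.re : ℂ) - z)⁻¹ :=
    (continuous_inv_ofReal_sub hz).comp Complex.continuous_re
  have hφc : Continuous fun w : ℂ => (φ w.re : ℂ) :=
    Complex.continuous_ofReal.comp (hφ.comp Complex.continuous_re)
  have h1 : (1 : H →L[ℂ] H) - cfc φ A = cfc (fun w : ℂ => 1 - (φ w.re : ℂ)) A := by
    rw [cfc_real_eq_complex φ hA, cfc_sub (fun _ => (1 : ℂ)) (fun w : ℂ => (φ w.re : ℂ)) A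
      continuousOn_const hφc.continuousOn, cfc_const_one ℂ A]
  rw [h1, resolventAt_eq_cfc hA hz, ← cfc_mul _ _ A hc.continuousOn hc.continuousOn,
    ← cfc_mul (fun w : ℂ => ((w.re : ℂ) - z)⁻¹ * ((w.re : ℂ) - z)⁻¹) (fun w : ℂ => 1 - (φ w.re : ℂ)) A
      (hc.mul hc).continuousOn (continuous_const.sub hφc).continuousOn]
  refine norm_cfc_le (by positivity) fun w _ => ?_
  by_cases hw : φ w.re = 1
  · simp only [hw, Complex.ofReal_one, sub_self, mul_zero, norm_zero]
    positivity
  · have h2 := h _ hw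
    have h3 : ‖(1 : ℂ) - (φ w.re : ℂ)‖ ≤ 1 := by
      rw [← Complex.ofReal_one, ← Complex.ofReal_sub, Complex.norm_real, Real.norm_eq_abs, abs_le]
      constructor <;> linarith [(hφ01 w.re).1, (hφ01 w.re).2]
    rw [norm_mul, norm_mul, norm_inv, ← mul_inv, ← pow_two]
    calc (‖(w.re : ℂ) - z‖ ^ 2)⁻¹ * ‖(1 : ℂ) - (φ w.re : ℂ)‖ ≤ (d ^ 2)⁻¹ * 1 := by gcongr
      _ = _ := mul_one _

/-- The tent function: `1` within distance `ρ` of `x₀`, `0` beyond distance `2 ρ`, and linear in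
between. -/
noncomputable def tent (x₀ ρ x : ℝ) : ℝ := max 0 (min 1 (2 - |x - x₀| / ρ))

theorem continuous_tent (x₀ ρ : ℝ) : Continuous (tent x₀ ρ) := by
  unfold tent
  fun_prop

theorem tent_mem (x₀ ρ x : ℝ) : 0 ≤ tent x₀ ρ x ∧ tent x₀ ρ x ≤ 1 :=
  ⟨le_max_left _ _, max_le zero_le_one (min_le_left _ _)⟩

theorem tent_eq_one {x₀ ρ x : ℝ} (hρ : 0 < ρ) (h : |x - x₀| ≤ ρ) : tent x₀ ρ x = 1 := by
  have h1 : |x - x₀| / ρ ≤ 1 := (div_le_one hρ).2 h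
  rw [tent, min_eq_left (by linarith), max_eq_right zero_le_one]

theorem tent_eq_zero {x₀ ρ x : ℝ} (hρ : 0 < ρ) (h : 2 * ρ ≤ |x - x₀|) : tent x₀ ρ x = 0 := by
  have h1 : 2 ≤ |x - x₀| / ρ := (le_div_iff₀ hρ).2 h
  exact max_eq_left ((min_le_right _ _).trans (by linarith))

theorem tsupport_tent_subset {x₀ ρ : ℝ} (hρ : 0 < ρ) :
    tsupport (tent x₀ ρ) ⊆ Icc (x₀ - 2 * ρ) (x₀ + 2 * ρ) := by
  refine closure_minimal (fun x hx => ?_) isClosed_Icc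
  by_contra hx'
  refine hx (tent_eq_zero hρ ?_)
  by_contra hlt
  push Not at hlt
  rw [abs_lt] at hlt
  exact hx' ⟨by linarith [hlt.1], by linarith [hlt.2]⟩

/-- The increment is at most `1` and at most `|x - y| / ρ`, and `min 1 t ≤ t ^ γ`. -/
theorem abs_tent_sub_le {x₀ ρ γ : ℝ} (hρ : 0 < ρ) (hγ : 0 ≤ γ) (hγ' : γ ≤ 1) (x y : ℝ) :
    |tent x₀ ρ x - tent x₀ ρ y| ≤ (1 / ρ) ^ γ * |x - y| ^ γ := by
  rw [← Real.mul_rpow (by positivity) (abs_nonneg _)]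
  have h1 : |tent x₀ ρ x - tent x₀ ρ y| ≤ 1 := by
    rw [abs_le]
    constructor <;> linarith [(tent_mem x₀ ρ x).1, (tent_mem x₀ ρ x).2, (tent_mem x₀ ρ y).1,
      (tent_mem x₀ ρ y).2]
  have h2 : |tent x₀ ρ x - tent x₀ ρ y| ≤ 1 / ρ * |x - y| := by
    calc |tent x₀ ρ x - tent x₀ ρ y|
        ≤ |min 1 (2 - |x - x₀| / ρ) - min 1 (2 - |y - x₀| / ρ)| := by
          rw [tent, tent, max_comm 0, max_comm 0]
          exact abs_max_sub_max_le_abs _ _ 0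
      _ ≤ |(2 - |x - x₀| / ρ) - (2 - |y - x₀| / ρ)| := by
          have := abs_min_sub_min_le_max 1 (2 - |x - x₀| / ρ) 1 (2 - |y - x₀| / ρ)
          simpa using this
      _ = 1 / ρ * |(|y - x₀| - |x - x₀|)| := by
          have h3 : |1 / ρ * (|y - x₀| - |x - x₀|)| = 1 / ρ * |(|y - x₀| - |x - x₀|)| := by
            rw [abs_mul, abs_of_pos (one_div_pos.2 hρ)]
          rw [← h3]
          congr 1
          ring
      _ ≤ 1 / ρ * |x - y| := by
          refine mul_le_mul_of_nonneg_left ?_ (by positivity)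
          refine (abs_abs_sub_abs_le _ _).trans_eq ?_
          rw [abs_sub_comm]
          congr 1
          ring
  rcases le_total (1 / ρ * |x - y|) 1 with h3 | h3
  · rcases (by positivity : 0 ≤ 1 / ρ * |x - y|).eq_or_lt with h4 | h4
    · rw [← h4] at h2
      exact h2.trans (by positivity)
    · refine h2.trans ?_
      calc 1 / ρ * |x - y| = (1 / ρ * |x - y|) ^ (1 : ℝ) := (Real.rpow_one _).symm
        _ ≤ _ := Real.rpow_le_rpow_of_exponent_ge h4 h3 hγ'
  · exact h1.trans (Real.one_le_rpow h3 hγ)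

/-- `k` is controlled only on `I`. If just one of the points lies in `I`, the cutoff vanishes at the
other and its own Hölder bound suffices. -/
theorem norm_ofReal_mul_sub_le {φ : ℝ → ℝ} {k : ℝ → ℂ} {I : Set ℝ} {γ L N N' : ℝ}
    (hLN : 0 ≤ L * N) (hN' : 0 ≤ N') (hφ : ∀ x y, |φ x - φ y| ≤ L * |x - y| ^ γ) (hφ1 : ∀ x, |φ x| ≤ 1)
    (hφ0 : ∀ x, x ∉ I → φ x = 0) (hk : ∀ x ∈ I, ‖k x‖ ≤ N)
    (hk' : ∀ x ∈ I, ∀ y ∈ I, ‖k x - k y‖ ≤ N' * |x - y| ^ γ) (x y : ℝ) :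
    ‖(φ x : ℂ) * k x - (φ y : ℂ) * k y‖ ≤ (L * N + N') * |x - y| ^ γ := by
  have hone : ∀ x y, x ∈ I → ‖((φ x - φ y : ℝ) : ℂ) * k x‖ ≤ L * N * |x - y| ^ γ := by
    intro x y hx
    rw [norm_mul, Complex.norm_real, Real.norm_eq_abs]
    calc |φ x - φ y| * ‖k x‖ ≤ (L * |x - y| ^ γ) * N :=
          mul_le_mul (hφ x y) (hk x hx) (norm_nonneg _) ((abs_nonneg _).trans (hφ x y))
      _ = _ := by ring
  have hnn : 0 ≤ N' * |x - y| ^ γ := by positivity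
  rw [add_mul]
  by_cases hx : x ∈ I
  · by_cases hy : y ∈ I
    · have h1 : (φ x : ℂ) * k x - (φ y : ℂ) * k y
          = ((φ x - φ y : ℝ) : ℂ) * k x + (φ y : ℂ) * (k x - k y) := by push_cast; ring
      rw [h1]
      refine (norm_add_le _ _).trans (add_le_add (hone x y hx) ?_)
      rw [norm_mul, Complex.norm_real, Real.norm_eq_abs]
      calc |φ y| * ‖k x - k y‖ ≤ 1 * (N' * |x - y| ^ γ) :=
            mul_le_mul (hφ1 y) (hk' x hx y hy) (norm_nonneg _) zero_le_one
        _ = _ := one_mul _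
    · have h1 : (φ x : ℂ) * k x - (φ y : ℂ) * k y = ((φ x - φ y : ℝ) : ℂ) * k x := by
        rw [hφ0 y hy]; simp
      rw [h1]
      linarith [hone x y hx]
  · by_cases hy : y ∈ I
    · have h1 : (φ x : ℂ) * k x - (φ y : ℂ) * k y = -(((φ y - φ x : ℝ) : ℂ) * k y) := by
        rw [hφ0 x hx]; simp
      rw [h1, norm_neg, abs_sub_comm]
      rw [abs_sub_comm] at hnn
      linarith [hone y x hy]
    · have h1 : (φ x : ℂ) * k x - (φ y : ℂ) * k y = 0 := by
        rw [hφ0 x hx, hφ0 y hy]; simp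
      rw [h1, norm_zero]
      positivity

variable {h : Type*} [NormedAddCommGroup h] [InnerProductSpace ℂ h]

/-- A tent cutoff `φ` at `x₀` splits `R²` into `R² φ(A)`, an integral of `(x - z)⁻²` against a
Hölder function, and `R² (1 - φ(A))`, which is bounded near `x₀`. -/
theorem StronglySmooth.exists_norm_resolventAt_sq_le {A Q : H →L[ℂ] H} {a b γ : ℝ}
    (hA : IsSelfAdjoint A) (hγ : 0 < γ) (hγ' : γ < 1) (hQ : StronglySmooth h A Q (Ioo a b) γ)
    {x₀ : ℝ} (hx₀ : x₀ ∈ Ioo a b) :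
    ∃ r > 0, ∃ C ≥ 0, ∀ z ∈ Metric.ball (x₀ : ℂ) r, z.im ≠ 0 →
      ‖Q * (resolventAt A z * resolventAt A z) * star Q‖ ≤ C * |z.im| ^ (γ - 1) := by
  obtain ⟨F, hF, u, hu, hsm⟩ := hQ
  obtain ⟨ρ, hρ, hρ1, hρI⟩ : ∃ ρ > 0, ρ ≤ 1 ∧ Icc (x₀ - 2 * ρ) (x₀ + 2 * ρ) ⊆ Ioo a b := by
    refine ⟨min 1 (min (x₀ - a) (b - x₀) / 3), ?_, min_le_left _ _, fun x hx => ?_⟩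
    · have := sub_pos.2 hx₀.1
      have := sub_pos.2 hx₀.2
      positivity
    · have h1 := min_le_right 1 (min (x₀ - a) (b - x₀) / 3)
      have h2 := min_le_left (x₀ - a) (b - x₀)
      have h3 := min_le_right (x₀ - a) (b - x₀)
      constructor <;> linarith [hx.1, hx.2, hx₀.1, hx₀.2]
  obtain ⟨C, hC⟩ := hsm _ _ hρI
  set I := Icc (x₀ - 2 * ρ) (x₀ + 2 * ρ) with hI
  have hb1 : ∀ g, ∀ x ∈ I, ‖u g x‖ ≤ |C| * ‖g‖ := fun g x hx =>
    ((hC g x hx x hx).1).trans (mul_le_mul_of_nonneg_right (le_abs_self C) (norm_nonneg g))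
  have hb2 : ∀ g, ∀ x ∈ I, ∀ y ∈ I, ‖u g x - u g y‖ ≤ |C| * |x - y| ^ γ * ‖g‖ := fun g x hx y hy =>
    ((hC g x hx y hy).2).trans (mul_le_mul_of_nonneg_right
      (mul_le_mul_of_nonneg_right (le_abs_self C) (by positivity)) (norm_nonneg g))
  set φ := tent x₀ ρ with hφ
  have hφc : Continuous φ := continuous_tent x₀ ρ
  have hφs : tsupport φ ⊆ Ioo a b := (tsupport_tent_subset hρ).trans hρI
  have hφ0 : ∀ x, x ∉ I → φ x = 0 := fun x hx =>
    image_eq_zero_of_notMem_tsupport fun hx' => hx (tsupport_tent_subset hρ hx')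
  set κ : ℝ := ∫ t : ℝ, |t| ^ γ / (1 + t ^ 2) with hκ
  have hκ0 : 0 ≤ κ := integral_nonneg fun t => by positivity
  -- The Hölder constant of `φ ⟨u f, u g⟩` per unit `‖f‖ ‖g‖`: that of the tent times the bound
  -- `|C|²`, plus `2 |C|²` from the two factors of the inner product.
  set D : ℝ := ((1 / ρ) ^ γ * (|C| ^ 2) + 2 * |C| ^ 2) * κ with hD
  have hD0 : 0 ≤ D := by positivity
  -- The tent is `1` within `ρ` of `x₀`, so where `φ ≠ 1` the distance to `z` is at least `ρ / 2`.
  -- The bounded far term is absorbed because `|Im z| ^ (γ - 1) ≥ 1`.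
  refine ⟨ρ / 2, by positivity, D + ‖Q‖ * ((ρ / 2) ^ 2)⁻¹ * ‖Q‖, by positivity, fun z hz hzi => ?_⟩
  have hz1 : ‖z - x₀‖ < ρ / 2 := by simpa [dist_eq_norm] using hz
  have hzi1 : |z.im| ≤ 1 := by
    have h1 : |z.im| ≤ ‖z - x₀‖ := by simpa using Complex.abs_im_le_norm (z - x₀)
    linarith
  have hone : 1 ≤ |z.im| ^ (γ - 1) :=
    Real.one_le_rpow_of_pos_of_le_one_of_nonpos (abs_pos.2 hzi) hzi1 (by linarith)
  set R := resolventAt A z with hR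
  have hsplit : Q * (R * R) * star Q = Q * (R * R * cfc φ A) * star Q
      + Q * (R * R * (1 - cfc φ A)) * star Q := by noncomm_ring
  have hfar : ‖Q * (R * R * (1 - cfc φ A)) * star Q‖ ≤ ‖Q‖ * ((ρ / 2) ^ 2)⁻¹ * ‖Q‖ := by
    have h1 := norm_resolventAt_sq_mul_one_sub_cfc_le hA hzi hφc (tent_mem x₀ ρ) (d := ρ / 2)
      (by positivity) fun x hx => by
        have h2 : ρ < |x - x₀| := by
          by_contra hle
          exact hx (tent_eq_one hρ (not_lt.1 hle))
        have h3 : ‖(x : ℂ) - x₀‖ = |x - x₀| := by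
          rw [← Complex.ofReal_sub, Complex.norm_real, Real.norm_eq_abs]
        have h4 : ‖(x : ℂ) - x₀‖ ≤ ‖(x : ℂ) - z‖ + ‖z - x₀‖ :=
          norm_sub_le_norm_sub_add_norm_sub _ _ _
        linarith
    refine (norm_mul_le _ _).trans ?_
    rw [norm_star]
    gcongr
    exact (norm_mul_le _ _).trans (mul_le_mul_of_nonneg_left h1 (norm_nonneg _))
  have hnear : ‖Q * (R * R * cfc φ A) * star Q‖ ≤ D * |z.im| ^ (γ - 1) := by
    refine opNorm_le_of_norm_inner_le (by positivity) fun f g => ?_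
    have h1 : inner ℂ f ((Q * (R * R * cfc φ A) * star Q) g)
        = inner ℂ (star Q f) ((R * R * cfc φ A) (star Q g)) :=
      (ContinuousLinearMap.adjoint_inner_left Q _ _).symm
    rw [h1, hF.inner_resolventAt_sq_cfc hA isOpen_Ioo (Metric.isBounded_Ioo a b) hφc hφs hzi]
    have h2 : ∫ x in Ioo a b, (((x : ℂ) - z) ^ 2)⁻¹ * ((φ x : ℂ) *
        inner ℂ ((F ((spectralSubspace A (Ioo a b)).orthogonalProjectionOnto (star Q f)) : ℝ → h) x)
          ((F ((spectralSubspace A (Ioo a b)).orthogonalProjectionOnto (star Q g)) : ℝ → h) x))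
        = ∫ x in Ioo a b, (((x : ℂ) - z) ^ 2)⁻¹ * ((φ x : ℂ) * inner ℂ (u f x) (u g x)) := by
      refine integral_congr_ae ?_
      filter_upwards [hu f, hu g] with x hx hx'
      rw [← hx, ← hx']
      rfl
    have h3 : ∫ x in Ioo a b, (((x : ℂ) - z) ^ 2)⁻¹ * ((φ x : ℂ) * inner ℂ (u f x) (u g x))
        = ∫ x : ℝ, (((x : ℂ) - z) ^ 2)⁻¹ * ((φ x : ℂ) * inner ℂ (u f x) (u g x)) :=
      setIntegral_eq_integral_of_forall_compl_eq_zero fun x hx => by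
        rw [hφ0 x fun hx' => hx (hρI hx')]
        simp
    rw [h2, h3]
    have h4 : ∀ x ∈ I, ‖inner ℂ (u f x) (u g x)‖ ≤ |C| ^ 2 * (‖f‖ * ‖g‖) := fun x hx => by
      calc ‖inner ℂ (u f x) (u g x)‖ ≤ ‖u f x‖ * ‖u g x‖ := norm_inner_le_norm _ _
        _ ≤ (|C| * ‖f‖) * (|C| * ‖g‖) :=
            mul_le_mul (hb1 f x hx) (hb1 g x hx) (norm_nonneg _) (by positivity)
        _ = _ := by ring
    have h5 : ∀ x ∈ I, ∀ y ∈ I, ‖inner ℂ (u f x) (u g x) - inner ℂ (u f y) (u g y)‖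
        ≤ 2 * |C| ^ 2 * (‖f‖ * ‖g‖) * |x - y| ^ γ := fun x hx y hy => by
      have h6 : inner ℂ (u f x) (u g x) - inner ℂ (u f y) (u g y)
          = inner ℂ (u f x - u f y) (u g x) + inner ℂ (u f y) (u g x - u g y) := by
        rw [inner_sub_left, inner_sub_right]
        ring
      rw [h6]
      calc _ ≤ ‖u f x - u f y‖ * ‖u g x‖ + ‖u f y‖ * ‖u g x - u g y‖ :=
            (norm_add_le _ _).trans (add_le_add (norm_inner_le_norm _ _) (norm_inner_le_norm _ _))
        _ ≤ (|C| * |x - y| ^ γ * ‖f‖) * (|C| * ‖g‖) + (|C| * ‖f‖) * (|C| * |x - y| ^ γ * ‖g‖) :=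
            add_le_add (mul_le_mul (hb2 f x hx y hy) (hb1 g x hx) (norm_nonneg _) (by positivity))
              (mul_le_mul (hb1 f y hy) (hb2 g x hx y hy) (norm_nonneg _) (by positivity))
        _ = _ := by ring
    have h7 := norm_integral_inv_sq_mul_le hγ.le hγ' (norm_ofReal_mul_sub_le (by positivity) (by positivity)
      (abs_tent_sub_le (x₀ := x₀) hρ hγ.le hγ'.le)
      (fun x => abs_le.2 ⟨by linarith [(tent_mem x₀ ρ x).1], (tent_mem x₀ ρ x).2⟩) hφ0 h4 h5) hzi
    refine h7.trans_eq ?_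
    rw [hD]
    ring
  rw [hsplit, add_mul]
  refine (norm_add_le _ _).trans (add_le_add hnear (hfar.trans ?_))
  exact le_mul_of_one_le_right (by positivity) hone

theorem StronglySmooth.holderNear {A Q : H →L[ℂ] H} {a b γ : ℝ}
    (hA : IsSelfAdjoint A) (hγ : 0 < γ) (hγ' : γ < 1) (hQ : StronglySmooth h A Q (Ioo a b) γ)
    {x₀ : ℝ} (hx₀ : x₀ ∈ Ioo a b) (s : ℤˣ) :
    HolderNear (fun z => Q * resolventAt A z * star Q) (halfPlane s) γ x₀ := by
  have h1 : HolderNear (fun z => Q * resolventAt A z * star Q) (halfPlane 1) γ x₀ := by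
    obtain ⟨r, hr, C, hC, hb⟩ := hQ.exists_norm_resolventAt_sq_le hA hγ hγ' hx₀
    refine holderNear_of_norm_deriv_le (F' := fun z => Q * (resolventAt A z * resolventAt A z) * star Q)
      hγ hγ'.le hr hC (fun z hz => ?_) fun z hz hzi => ?_
    · exact ((hasDerivAt_resolventAt hA hz.ne').const_mul Q).mul_const (star Q)
    · have := hb z hz hzi.ne'
      rwa [abs_of_pos hzi] at this
  rcases Int.units_eq_one_or s with rfl | rfl
  · exact h1
  · refine h1.star_conj fun z _ => ?_
    rw [star_mul, star_mul, star_star, star_resolventAt hA, star_star, mul_assoc]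

end SmoothResolvent

/-! ### The exceptional sets are relatively closed and null -/

section ExceptionalSet

variable {H : Type*} [NormedAddCommGroup H] [InnerProductSpace ℂ H]

theorem neBot_nhdsWithin_halfPlane_ofReal (s : ℤˣ) (x : ℝ) : NeBot (𝓝[halfPlane s] (x : ℂ)) :=
  neBot_nhdsWithin_halfPlane (by simp)

/-- Boundary values stay in any neighbourhood `W` of the boundary value at `x₀`, near `x₀`. -/
theorem exists_ball_boundaryValue_mem {G : ℂ → H →L[ℂ] H} {s : ℤˣ} {x₀ : ℝ} {B₀ : H →L[ℂ] H}
    (hB₀ : IsBoundaryValue G s x₀ B₀) {W : Set (H →L[ℂ] H)} (hW : W ∈ 𝓝 B₀) :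
    ∃ R > 0, (∀ z ∈ halfPlane s ∩ Metric.ball (x₀ : ℂ) R, G z ∈ W) ∧
      ∀ x : ℝ, |x - x₀| < R → ∀ B, IsBoundaryValue G s x B → B ∈ W := by
  -- A closed ball inside `W` retains limits of values lying in it.
  obtain ⟨ε, hε, hεW⟩ := Metric.nhds_basis_closedBall.mem_iff.1 hW
  obtain ⟨R, hR, hRε⟩ := Metric.mem_nhdsWithin_iff.1 (hB₀ (Metric.closedBall_mem_nhds B₀ hε))
  refine ⟨R, hR, fun z hz => hεW (hRε ⟨hz.2, hz.1⟩), fun x hx B hB => hεW ?_⟩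
  have := neBot_nhdsWithin_halfPlane_ofReal s x
  refine Metric.isClosed_closedBall.mem_of_tendsto hB ?_
  have hxR : (x : ℂ) ∈ Metric.ball (x₀ : ℂ) R := by
    rw [Metric.mem_ball, dist_eq_norm, ← Complex.ofReal_sub, Complex.norm_real, Real.norm_eq_abs]
    exact hx
  filter_upwards [self_mem_nhdsWithin, mem_nhdsWithin_of_mem_nhds (Metric.isOpen_ball.mem_nhds hxR)]
    with z hz hz'
  exact hRε ⟨hz', hz⟩

variable [CompleteSpace H]

theorem isCompactOperator_sq_of_isBoundaryValue {G : ℂ → H →L[ℂ] H} {s : ℤˣ}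
    (hG : ∀ z ∈ halfPlane s, IsCompactOperator (G z * G z)) {x : ℝ} {B : H →L[ℂ] H}
    (hB : IsBoundaryValue G s x B) : IsCompactOperator (B * B) := by
  have := neBot_nhdsWithin_halfPlane_ofReal s x
  have hcl : IsClosed {f : H →L[ℂ] H | IsCompactOperator f} := isClosed_setOfPred_isCompactOperator
  have h1 : Tendsto (fun z => G z * G z) (𝓝[halfPlane s] (x : ℂ)) (𝓝 (B * B)) :=
    Tendsto.mul hB hB
  exact hcl.mem_of_tendsto h1 (eventually_of_mem self_mem_nhdsWithin hG)

theorem isUnit_one_add_of_notMem_exceptionalSet {G : ℂ → H →L[ℂ] H} {s : ℤˣ} {Δ : Set ℝ}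
    (hG : ∀ z ∈ halfPlane s, IsCompactOperator (G z * G z)) {x : ℝ} {B : H →L[ℂ] H}
    (hB : IsBoundaryValue G s x B) (hx : x ∈ Δ) (hx' : x ∉ exceptionalSet G Δ s) :
    IsUnit (1 + B) := by
  refine isUnit_one_add_of_isCompactOperator_sq (isCompactOperator_sq_of_isBoundaryValue hG hB)
    fun g hg => ?_
  by_contra h0
  exact hx' ⟨hx, B, hB, g, h0, hg⟩

/-- Invertibility of `1 + X` is an open condition, and boundary values near `x₀` stay close to the
one at `x₀`. -/
theorem exists_isClosed_exceptionalSet_eq {G : ℂ → H →L[ℂ] H} {s : ℤˣ} {Δ : Set ℝ}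
    (hG : ∀ z ∈ halfPlane s, IsCompactOperator (G z * G z))
    (hlim : ∀ x ∈ Δ, ∃ B, IsBoundaryValue G s x B) :
    ∃ S : Set ℝ, IsClosed S ∧ exceptionalSet G Δ s = S ∩ Δ := by
  refine ⟨closure (exceptionalSet G Δ s), isClosed_closure, Subset.antisymm
    (fun x hx => ⟨subset_closure hx, hx.1⟩) ?_⟩
  rintro x₀ ⟨hxc, hxΔ⟩
  by_contra hx
  obtain ⟨B₀, hB₀⟩ := hlim x₀ hxΔ
  have hu := isUnit_one_add_of_notMem_exceptionalSet hG hB₀ hxΔ hx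
  have hW : {X : H →L[ℂ] H | IsUnit (1 + X)} ∈ 𝓝 B₀ :=
    (continuous_const.add continuous_id).continuousAt (Units.isOpen.mem_nhds hu)
  obtain ⟨R, hR, -, hRW⟩ := exists_ball_boundaryValue_mem hB₀ hW
  obtain ⟨y, hy, hyR⟩ := Metric.mem_closure_iff.1 hxc R hR
  obtain ⟨-, B, hB, g, hg, hg'⟩ := hy
  have hyB := hRW y (by rwa [dist_comm, Real.dist_eq] at hyR) B hB
  have h1 := ((ContinuousLinearMap.isUnit_iff_bijective).1 hyB).1
  exact hg (h1 (by rw [map_zero]; exact hg'))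

/-- Locally, `Φ ∘ G` is holomorphic with no zero in the half-disc, since `1 + G z` is injective
there, but it vanishes in the limit at exceptional points. -/
theorem volume_exceptionalSet_eq_zero {G : ℂ → H →L[ℂ] H} {s : ℤˣ} {Δ : Set ℝ} {γ : ℝ}
    (hΔ : IsOpen Δ) (hγ : 0 < γ)
    (hG : ∀ z ∈ halfPlane s, IsCompactOperator (G z * G z))
    (hGd : ∀ z ∈ halfPlane s, DifferentiableAt ℂ G z)
    (hGi : ∀ z ∈ halfPlane s, ∀ g : H, g + G z g = 0 → g = 0)
    (hGh : ∀ x ∈ Δ, HolderNear G (halfPlane s) γ x) :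
    volume (exceptionalSet G Δ s) = 0 := by
  have hlim : ∀ x ∈ Δ, ∃ B, IsBoundaryValue G s x B := fun x hx =>
    have := neBot_nhdsWithin_halfPlane_ofReal s x
    (hGh x hx).exists_tendsto hγ
  obtain ⟨S, hS, hSN⟩ := exists_isClosed_exceptionalSet_eq hG hlim
  have hNm : MeasurableSet (exceptionalSet G Δ s) := by
    rw [hSN]
    exact hS.measurableSet.inter hΔ.measurableSet
  refine measure_null_of_locally_null _ fun x₀ hx₀ => ?_
  obtain ⟨B₀, hB₀⟩ := hlim x₀ hx₀.1
  obtain ⟨Φ, hΦ, hΦe⟩ := exists_determinant_of_isCompactOperator_sq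
    (isCompactOperator_sq_of_isBoundaryValue hG hB₀)
  have hΦd : ∀ᶠ X in 𝓝 B₀, DifferentiableAt ℂ Φ X :=
    (hΦ.eventually (by simp)).mono fun X hX => hX.differentiableAt one_ne_zero
  obtain ⟨R₁, hR₁, hW, hWB⟩ := exists_ball_boundaryValue_mem hB₀ (hΦd.and hΦe)
  obtain ⟨R₂, hR₂, C, hC⟩ := (hGh x₀ hx₀.1).comp_contDiffAt hB₀ hΦ
  set R := min R₁ R₂ with hR
  have hR0 : 0 < R := lt_min hR₁ hR₂
  have hRW : ∀ z ∈ halfPlane s ∩ Metric.ball (x₀ : ℂ) R, _ := fun z hz =>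
    hW z ⟨hz.1, Metric.ball_subset_ball (min_le_left _ _) hz.2⟩
  have hRC : ∀ z ∈ halfPlane s ∩ Metric.ball (x₀ : ℂ) R, ∀ w ∈ halfPlane s ∩ Metric.ball (x₀ : ℂ) R,
      ‖Φ (G z) - Φ (G w)‖ ≤ C * ‖z - w‖ ^ γ := fun z hz w hw =>
    hC z ⟨hz.1, Metric.ball_subset_ball (min_le_right _ _) hz.2⟩ w
      ⟨hw.1, Metric.ball_subset_ball (min_le_right _ _) hw.2⟩
  have hfd : ∀ z ∈ halfPlane s ∩ Metric.ball (x₀ : ℂ) R, DifferentiableAt ℂ (fun z => Φ (G z)) z :=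
    fun z hz => (hRW z hz).1.comp z (hGd z hz.1)
  have hne := neBot_nhdsWithin_halfPlane_ofReal s x₀
  obtain ⟨z₀, hz₀⟩ : (halfPlane s ∩ Metric.ball (x₀ : ℂ) R).Nonempty :=
    hne.nonempty_of_mem (inter_mem_nhdsWithin _ (Metric.ball_mem_nhds _ hR0))
  refine ⟨exceptionalSet G Δ s ∩ Icc (x₀ - R / 8) (x₀ + R / 8),
    inter_mem_nhdsWithin _ (Icc_mem_nhds (by linarith) (by linarith)), ?_⟩
  by_contra hpos
  -- The window `R / 8` is the one allowed by the uniqueness theorem; `M` comes from comparing with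
  -- `z₀`, as any two points of the half-disc are within `2 R`.
  have hex := exists_eq_zero_of_boundary_zeros (f := fun z => Φ (G z))
    (M := ‖Φ (G z₀)‖ + |C| * (2 * R) ^ γ) (C := C) hR0 hγ
    (fun z hz => (hfd z hz).differentiableWithinAt) ?_ (hNm.inter measurableSet_Icc)
    inter_subset_right hpos ?_
  · obtain ⟨z, hz, hz0⟩ := hex
    obtain ⟨g, hg, hg'⟩ := (hRW z hz).2.2 hz0
    exact hg (hGi z hz.1 g hg')
  · intro z hz
    have h1 := hRC z hz z₀ hz₀
    have h2 : ‖z - z₀‖ ≤ 2 * R := by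
      rw [← dist_eq_norm]
      have h3 : dist z x₀ < R := hz.2
      have h4 : dist z₀ x₀ < R := hz₀.2
      linarith [dist_triangle_right z z₀ (x₀ : ℂ)]
    have h5 : ‖Φ (G z)‖ ≤ ‖Φ (G z₀)‖ + ‖Φ (G z) - Φ (G z₀)‖ := norm_le_norm_add_norm_sub' _ _
    have h6 : C * ‖z - z₀‖ ^ γ ≤ |C| * (2 * R) ^ γ := by
      gcongr
      exact le_abs_self C
    linarith
  · rintro x ⟨⟨hxΔ, B, hB, g, hg, hg'⟩, hxI⟩ z hz
    have hxR : |x - x₀| < R := by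
      rw [abs_lt]
      constructor <;> linarith [hxI.1, hxI.2]
    have hBW := hWB x (hxR.trans_le (min_le_left _ _)) B hB
    have hΦB : Φ B = 0 := by
      by_contra h0
      have h1 := ((ContinuousLinearMap.isUnit_iff_bijective).1 (hBW.2.1 h0)).1
      exact hg (h1 (by rw [map_zero]; exact hg'))
    have hxb : (x : ℂ) ∈ Metric.ball (x₀ : ℂ) R := by
      rw [Metric.mem_ball, dist_eq_norm, ← Complex.ofReal_sub, Complex.norm_real, Real.norm_eq_abs]
      exact hxR
    have := neBot_nhdsWithin_halfPlane_ofReal s x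
    have : NeBot (𝓝[halfPlane s] z) := neBot_nhdsWithin_halfPlane (le_of_lt hz.1)
    -- Let one argument of the Hölder bound tend to `x`, where `Φ B = 0`; this is the uniform decay
    -- required on the exceptional set.
    have h2 := norm_sub_le_of_tendsto_of_holder (F := fun z => Φ (G z)) hγ Metric.isOpen_ball hRC
      hz.2 hxb ((hfd z hz).continuousAt.tendsto.mono_left inf_le_left)
      (hBW.1.continuousAt.tendsto.comp hB)
    rwa [hΦB, sub_zero] at h2

end ExceptionalSet

/-! ### From local to uniform Hölder bounds for the extended sandwiched resolvent -/

section SandwichedResolvent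

variable {H₀ H : Type*} [NormedAddCommGroup H₀] [InnerProductSpace ℂ H₀] [CompleteSpace H₀]
  [NormedAddCommGroup H] [InnerProductSpace ℂ H] [CompleteSpace H]

/-- The sandwiched resolvent `X (A - z)⁻¹ X^*`. -/
noncomputable def sandwich (A : H →L[ℂ] H) (X : H →L[ℂ] H₀) (z : ℂ) : H₀ →L[ℂ] H₀ :=
  X ∘L resolventAt A z ∘L ContinuousLinearMap.adjoint X

variable {A : H →L[ℂ] H} {X : H →L[ℂ] H₀}

theorem star_sandwich (hA : IsSelfAdjoint A) (z : ℂ) :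
    star (sandwich A X z) = sandwich A X (star z) := by
  rw [sandwich, sandwich, ← star_resolventAt hA, ContinuousLinearMap.star_eq_adjoint,
    ContinuousLinearMap.adjoint_comp, ContinuousLinearMap.adjoint_comp,
    ContinuousLinearMap.adjoint_adjoint, ContinuousLinearMap.comp_assoc]
  rfl

theorem norm_comp_comp_adjoint_le (T : H →L[ℂ] H) :
    ‖X ∘L T ∘L ContinuousLinearMap.adjoint X‖ ≤ ‖X‖ ^ 2 * ‖T‖ := by
  have h1 : ‖ContinuousLinearMap.adjoint X‖ = ‖X‖ := LinearIsometryEquiv.norm_map _ _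
  calc ‖X ∘L T ∘L ContinuousLinearMap.adjoint X‖
      ≤ ‖X‖ * (‖T‖ * ‖ContinuousLinearMap.adjoint X‖) :=
        (ContinuousLinearMap.opNorm_comp_le _ _).trans
          (mul_le_mul_of_nonneg_left (ContinuousLinearMap.opNorm_comp_le _ _) (norm_nonneg _))
    _ = _ := by rw [h1]; ring

theorem norm_sandwich_le (hA : IsSelfAdjoint A) {z : ℂ} {d : ℝ} (hd : 0 < d) (hz : d ≤ |z.im|) :
    ‖sandwich A X z‖ ≤ ‖X‖ ^ 2 * d⁻¹ := by
  refine (norm_comp_comp_adjoint_le _).trans (mul_le_mul_of_nonneg_left ?_ (by positivity))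
  exact (norm_resolventAt_le hA (abs_pos.1 (hd.trans_le hz))).trans (inv_anti₀ hd hz)

theorem norm_sandwich_sub_le (hA : IsSelfAdjoint A) {z w : ℂ} {d : ℝ} (hd : 0 < d)
    (hz : d ≤ |z.im|) (hw : d ≤ |w.im|) :
    ‖sandwich A X z - sandwich A X w‖ ≤ ‖X‖ ^ 2 * (d⁻¹ * d⁻¹) * ‖z - w‖ := by
  have hz0 := abs_pos.1 (hd.trans_le hz)
  have hw0 := abs_pos.1 (hd.trans_le hw)
  have h1 : sandwich A X z - sandwich A X w
      = X ∘L (resolventAt A z - resolventAt A w) ∘L ContinuousLinearMap.adjoint X := by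
    ext x
    simp [sandwich]
  rw [h1, resolventAt_sub_resolventAt hA hz0 hw0]
  refine (norm_comp_comp_adjoint_le _).trans ?_
  rw [norm_smul]
  calc ‖X‖ ^ 2 * (‖z - w‖ * ‖resolventAt A z * resolventAt A w‖)
      ≤ ‖X‖ ^ 2 * (‖z - w‖ * (d⁻¹ * d⁻¹)) := by
        gcongr
        refine (norm_mul_le _ _).trans (mul_le_mul ?_ ?_ (norm_nonneg _) (by positivity))
        · exact (norm_resolventAt_le hA hz0).trans (inv_anti₀ hd hz)
        · exact (norm_resolventAt_le hA hw0).trans (inv_anti₀ hd hw)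
    _ = _ := by ring

theorem continuousAt_sandwich (hA : IsSelfAdjoint A) {z : ℂ} (hz : z.im ≠ 0) :
    ContinuousAt (sandwich A X) z := by
  have h1 : ContinuousAt (resolventAt A) z := (hasDerivAt_resolventAt hA hz).continuousAt
  have h2 : Continuous fun T : H →L[ℂ] H => X ∘L T ∘L ContinuousLinearMap.adjoint X := by fun_prop
  exact h2.continuousAt.comp h1

/-- Local Hölder continuity at the points of a compact set is uniform. -/
theorem exists_uniform_holder_of_isCompact {E : Type*} [NormedAddCommGroup E] {F : ℂ → E}
    {D : Set ℂ} {γ : ℝ} {δ : Set ℝ} (hδ : IsCompact δ) (hF : ∀ x ∈ δ, HolderNear F D γ x) :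
    ∃ η > 0, ∃ C ≥ 0, ∀ x ∈ δ, ∀ z ∈ D ∩ Metric.ball (x : ℂ) η, ∀ w ∈ D ∩ Metric.ball (x : ℂ) η,
      ‖F z - F w‖ ≤ C * ‖z - w‖ ^ γ := by
  refine hδ.induction_on (p := fun S => ∃ η > 0, ∃ C ≥ 0, ∀ x ∈ S, ∀ z ∈ D ∩ Metric.ball (x : ℂ) η,
    ∀ w ∈ D ∩ Metric.ball (x : ℂ) η, ‖F z - F w‖ ≤ C * ‖z - w‖ ^ γ) ?_ ?_ ?_ ?_
  · exact ⟨1, one_pos, 0, le_rfl, fun x hx => absurd hx (notMem_empty x)⟩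
  · rintro S S' hSS' ⟨η, hη, C, hC0, hC⟩
    exact ⟨η, hη, C, hC0, fun x hx => hC x (hSS' hx)⟩
  · rintro S S' ⟨η, hη, C, hC0, hC⟩ ⟨η', hη', C', hC0', hC'⟩
    refine ⟨min η η', lt_min hη hη', max C C', le_max_of_le_left hC0, ?_⟩
    rintro x (hx | hx) z hz w hw
    · refine (hC x hx z ⟨hz.1, Metric.ball_subset_ball (min_le_left _ _) hz.2⟩ w
        ⟨hw.1, Metric.ball_subset_ball (min_le_left _ _) hw.2⟩).trans ?_
      exact mul_le_mul_of_nonneg_right (le_max_left _ _) (by positivity)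
    · refine (hC' x hx z ⟨hz.1, Metric.ball_subset_ball (min_le_right _ _) hz.2⟩ w
        ⟨hw.1, Metric.ball_subset_ball (min_le_right _ _) hw.2⟩).trans ?_
      exact mul_le_mul_of_nonneg_right (le_max_right _ _) (by positivity)
  · intro x hx
    obtain ⟨r, hr, C, hC⟩ := hF x hx
    refine ⟨Metric.ball x (r / 2), mem_nhdsWithin_of_mem_nhds (Metric.ball_mem_nhds _ (half_pos hr)),
      r / 2, half_pos hr, |C|, abs_nonneg C, fun y hy z hz w hw => ?_⟩
    have hsub : Metric.ball (y : ℂ) (r / 2) ⊆ Metric.ball (x : ℂ) r := by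
      refine Metric.ball_subset_ball' ?_
      have h1 : dist (y : ℂ) (x : ℂ) = dist y x := by
        rw [dist_eq_norm, ← Complex.ofReal_sub, Complex.norm_real, dist_eq_norm]
      have h2 : dist y x < r / 2 := hy
      linarith
    refine (hC z ⟨hz.1, hsub hz.2⟩ w ⟨hw.1, hsub hw.2⟩).trans ?_
    exact mul_le_mul_of_nonneg_right (le_abs_self C) (by positivity)

open Classical in
/-- The extension of `F` by its boundary values. -/
noncomputable def boundaryExtension {E : Type*} [NormedAddCommGroup E] (F : ℂ → E) (D : Set ℂ) (z : ℂ) : E :=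
  if z ∈ D then F z else @limUnder _ _ _ ⟨0⟩ (𝓝[D] z) F

/-- Compactness gives a uniform radius `η`. Nearby points close to the axis obey the local bound,
nearby points away from it a Lipschitz bound from the resolvent identity, and points far apart the
uniform bound of the extension. -/
theorem exists_norm_boundaryExtension_sub_le (hA : IsSelfAdjoint A) {s : ℤˣ} {γ : ℝ} (hγ : 0 < γ)
    (hγ' : γ ≤ 1) {δ : Set ℝ} (hδ : IsCompact δ)
    (hF : ∀ x ∈ δ, HolderNear (sandwich A X) (halfPlane s) γ x) :
    ∃ C : ℝ, ∀ z w : ℂ, z.re ∈ δ → w.re ∈ δ →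
      0 ≤ ((s : ℤ) : ℝ) * z.im → 0 ≤ ((s : ℤ) : ℝ) * w.im →
      ‖boundaryExtension (sandwich A X) (halfPlane s) z
        - boundaryExtension (sandwich A X) (halfPlane s) w‖ ≤ C * ‖z - w‖ ^ γ := by
  set B := boundaryExtension (sandwich A X) (halfPlane s) with hB
  have hin : ∀ z ∈ halfPlane s, B z = sandwich A X z := fun z hz => if_pos hz
  have him : ∀ z ∈ halfPlane s, z.im ≠ 0 := fun z hz h0 => by
    have : 0 < ((s : ℤ) : ℝ) * z.im := hz
    simp [h0] at this
  have hσ : |((s : ℤ) : ℝ)| = 1 := by rcases Int.units_eq_one_or s with h | h <;> simp [h]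
  have hσ0 : ((s : ℤ) : ℝ) ≠ 0 := fun h => by simp [h] at hσ
  have hlim : ∀ z : ℂ, z.re ∈ δ → 0 ≤ ((s : ℤ) : ℝ) * z.im →
      Tendsto (sandwich A X) (𝓝[halfPlane s] z) (𝓝 (B z)) := by
    intro z hz hzi
    by_cases hzD : z ∈ halfPlane s
    · rw [hin z hzD]
      exact (continuousAt_sandwich hA (him z hzD)).tendsto.mono_left inf_le_left
    · have h1 : z.im = 0 := by
        have h2 : ((s : ℤ) : ℝ) * z.im = 0 := le_antisymm (not_lt.1 hzD) hzi
        exact (mul_eq_zero.1 h2).resolve_left hσ0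
      have h3 : ((z.re : ℝ) : ℂ) = z := Complex.ext rfl (by simp [h1])
      have := neBot_nhdsWithin_halfPlane hzi
      have h4 := hF z.re hz
      rw [h3] at h4
      have h5 : B z = @limUnder _ _ _ ⟨0⟩ (𝓝[halfPlane s] z) (sandwich A X) := if_neg hzD
      rw [h5]
      exact tendsto_nhds_limUnder (h4.exists_tendsto hγ)
  obtain ⟨η', hη', C, hC0, hC'⟩ := exists_uniform_holder_of_isCompact hδ hF
  -- The cap at `1` keeps the distances below in the range where `t ≤ t ^ γ ≤ 1`.
  set η := min η' 1 with hη
  have hη0 : 0 < η := lt_min hη' one_pos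
  have hη1 : η ≤ 1 := min_le_right _ _
  have hC : ∀ x ∈ δ, ∀ z w : ℂ, z ∈ Metric.ball (x : ℂ) η → w ∈ Metric.ball (x : ℂ) η →
      z.re ∈ δ → w.re ∈ δ → 0 ≤ ((s : ℤ) : ℝ) * z.im → 0 ≤ ((s : ℤ) : ℝ) * w.im →
      ‖B z - B w‖ ≤ C * ‖z - w‖ ^ γ := by
    intro x hx z w hz hw hzδ hwδ hzi hwi
    have := neBot_nhdsWithin_halfPlane hzi
    have := neBot_nhdsWithin_halfPlane hwi
    refine norm_sub_le_of_tendsto_of_holder hγ (Metric.isOpen_ball (x := (x : ℂ)) (ε := η)) ?_ hz hw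
      (hlim z hzδ hzi) (hlim w hwδ hwi)
    exact fun z hz w hw => hC' x hx z ⟨hz.1, Metric.ball_subset_ball (min_le_left _ _) hz.2⟩ w
      ⟨hw.1, Metric.ball_subset_ball (min_le_left _ _) hw.2⟩
  have hfar : ∀ z : ℂ, 0 ≤ ((s : ℤ) : ℝ) * z.im → z.im ≠ 0 → z ∈ halfPlane s := fun z hz h0 =>
    lt_of_le_of_ne hz (mul_ne_zero hσ0 h0).symm
  have hre : ∀ z : ℂ, ‖z - (z.re : ℂ)‖ = |z.im| := fun z => by
    have h1 : z - (z.re : ℂ) = z.im * Complex.I := by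
      apply Complex.ext <;> simp
    rw [h1, norm_mul, Complex.norm_I, mul_one, Complex.norm_real, Real.norm_eq_abs]
  set M : ℝ := ‖X‖ ^ 2 * (η / 2)⁻¹ + C with hM
  have hM0 : 0 ≤ M := by positivity
  have hbdd : ∀ z : ℂ, z.re ∈ δ → 0 ≤ ((s : ℤ) : ℝ) * z.im → ‖B z‖ ≤ M := by
    intro z hz hzi
    by_cases hzη : η / 2 ≤ |z.im|
    · rw [hin z (hfar z hzi (abs_pos.1 ((half_pos hη0).trans_le hzη)))]
      exact (norm_sandwich_le hA (half_pos hη0) hzη).trans (le_add_of_nonneg_right hC0)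
    · push Not at hzη
      -- Near the axis, compare with the point at height `η / 2` above or below the same real part,
      -- where the resolvent bound applies.
      let z' : ℂ := ⟨z.re, ((s : ℤ) : ℝ) * (η / 2)⟩
      have hz'i : |z'.im| = η / 2 := by
        simp only [z']
        rw [abs_mul, hσ, one_mul, abs_of_pos (half_pos hη0)]
      have hσ2 : ((s : ℤ) : ℝ) * ((s : ℤ) : ℝ) = 1 := by
        rcases Int.units_eq_one_or s with h | h <;> simp [h]
      have hz'0 : 0 ≤ ((s : ℤ) : ℝ) * z'.im := by
        simp only [z']
        rw [← mul_assoc, hσ2, one_mul]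
        positivity
      have hb : ∀ w : ℂ, w.re = z.re → |w.im| ≤ η / 2 → w ∈ Metric.ball ((z.re : ℝ) : ℂ) η := by
        intro w hw hwi
        rw [Metric.mem_ball, dist_eq_norm, ← hw, hre]
        linarith
      have h1 := hC z.re hz z z' (hb z rfl hzη.le) (hb z' rfl hz'i.le) hz hz hzi hz'0
      have h2 : ‖z - z'‖ ≤ 1 := by
        have h3 : z - z' = (z - (z.re : ℂ)) - (z' - (z'.re : ℂ)) := by
          simp [z']
        rw [h3]
        refine (norm_sub_le _ _).trans ?_
        rw [hre, hre]
        linarith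
      have h4 : ‖z - z'‖ ^ γ ≤ 1 := Real.rpow_le_one (norm_nonneg _) h2 hγ.le
      have h5 : ‖B z'‖ ≤ ‖X‖ ^ 2 * (η / 2)⁻¹ := by
        rw [hin z' (hfar z' hz'0 (abs_pos.1 (by rw [hz'i]; positivity)))]
        exact norm_sandwich_le hA (half_pos hη0) hz'i.ge
      calc ‖B z‖ ≤ ‖B z'‖ + ‖B z - B z'‖ := norm_le_norm_add_norm_sub' _ _
        _ ≤ ‖X‖ ^ 2 * (η / 2)⁻¹ + C * 1 :=
            add_le_add h5 (h1.trans (mul_le_mul_of_nonneg_left h4 hC0))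
        _ = M := by rw [mul_one]
  -- One summand per regime; in the last one `‖z - w‖ ≥ η / 4`, so `(4 / η) ^ γ * ‖z - w‖ ^ γ ≥ 1`.
  refine ⟨C + ‖X‖ ^ 2 * ((η / 4)⁻¹ * (η / 4)⁻¹) + 2 * M * (4 / η) ^ γ, fun z w hz hw hzi hwi => ?_⟩
  have hp1 : 0 ≤ C * ‖z - w‖ ^ γ := by positivity
  have hp2 : 0 ≤ ‖X‖ ^ 2 * ((η / 4)⁻¹ * (η / 4)⁻¹) * ‖z - w‖ ^ γ := by positivity
  have hp3 : 0 ≤ 2 * M * (4 / η) ^ γ * ‖z - w‖ ^ γ := by positivity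
  rw [add_mul, add_mul]
  rcases lt_or_ge ‖z - w‖ (η / 4) with hd | hd
  · have hib : |z.im - w.im| ≤ ‖z - w‖ := by simpa using Complex.abs_im_le_norm (z - w)
    have hib2 := abs_sub_abs_le_abs_sub z.im w.im
    by_cases hzη : η / 2 ≤ |z.im|
    · have hwη : η / 4 ≤ |w.im| := by linarith
      rw [hin z (hfar z hzi (abs_pos.1 (by linarith))), hin w (hfar w hwi (abs_pos.1 (by linarith)))]
      have h1 := norm_sandwich_sub_le (X := X) (z := z) (w := w) hA (by positivity : 0 < η / 4)
        (by linarith) hwη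
      have h2 : ‖z - w‖ ≤ ‖z - w‖ ^ γ := by
        rcases (norm_nonneg (z - w)).eq_or_lt with h0 | h0
        · rw [← h0]
          positivity
        · calc ‖z - w‖ = ‖z - w‖ ^ (1 : ℝ) := (Real.rpow_one _).symm
            _ ≤ _ := Real.rpow_le_rpow_of_exponent_ge h0 (by linarith) hγ'
      have h3 := h1.trans (mul_le_mul_of_nonneg_left h2 (by positivity))
      linarith
    · push Not at hzη
      have h1 : z ∈ Metric.ball ((z.re : ℝ) : ℂ) η := by
        rw [Metric.mem_ball, dist_eq_norm, hre]
        linarith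
      have h2 : w ∈ Metric.ball ((z.re : ℝ) : ℂ) η := by
        rw [Metric.mem_ball, dist_eq_norm]
        have h3 : ‖w - (z.re : ℂ)‖ ≤ ‖w - z‖ + ‖z - (z.re : ℂ)‖ := norm_sub_le_norm_sub_add_norm_sub _ _ _
        rw [norm_sub_rev w z, hre] at h3
        linarith
      have h3 := hC z.re hz z w h1 h2 hz hw hzi hwi
      linarith
  · have h1 : 1 ≤ (4 / η) ^ γ * ‖z - w‖ ^ γ := by
      rw [← Real.mul_rpow (by positivity) (norm_nonneg _)]
      refine Real.one_le_rpow ?_ hγ.le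
      calc 1 = 4 / η * (η / 4) := by field_simp
        _ ≤ 4 / η * ‖z - w‖ := by gcongr
    have h2 : ‖B z - B w‖ ≤ 2 * M := by
      refine (norm_sub_le _ _).trans ?_
      linarith [hbdd z hz hzi, hbdd w hw hwi]
    have h3 : 2 * M ≤ 2 * M * (4 / η) ^ γ * ‖z - w‖ ^ γ := by
      rw [mul_assoc (2 * M)]
      exact le_mul_of_one_le_right (by positivity) h1
    linarith

end SandwichedResolvent

/-! ### The resolvent identity relating `R(z)`, `R₀(z)` and `G₀(z)` -/

section ResolventIdentity

variable {H₀ H : Type*} [NormedAddCommGroup H₀] [InnerProductSpace ℂ H₀] [CompleteSpace H₀]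
  [NormedAddCommGroup H] [InnerProductSpace ℂ H] [CompleteSpace H]
  {A₀ T Q₀ K M₀ : H₀ →L[ℂ] H₀} {A : H →L[ℂ] H} {J : H₀ →L[ℂ] H}

theorem gZero_eq (A₀ Q₀ K M₀ : H₀ →L[ℂ] H₀) (z : ℂ) :
    gZero A₀ Q₀ K M₀ z = -(z⁻¹ • star M₀) + z⁻¹ • (K * (Q₀ * resolventAt A₀ z * star Q₀)) := rfl

/-- In the expanded square every term contains `K` except `(M₀^*)² = (M₀²)^*`. -/
theorem isCompactOperator_gZero_sq (hK : IsCompactOperator K)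
    (hM₀' : IsCompactOperator (M₀ ∘L M₀)) (z : ℂ) :
    IsCompactOperator (gZero A₀ Q₀ K M₀ z * gZero A₀ Q₀ K M₀ z : H₀ →L[ℂ] H₀) := by
  set S : H₀ →L[ℂ] H₀ := star M₀ with hS
  set Y : H₀ →L[ℂ] H₀ := Q₀ * resolventAt A₀ z * star Q₀ with hY
  have hSS : IsCompactOperator (S * S : H₀ →L[ℂ] H₀) := by
    have h1 := hM₀'.adjoint_of_hilbert
    rwa [ContinuousLinearMap.adjoint_comp] at h1
  have hKY : IsCompactOperator (K * Y : H₀ →L[ℂ] H₀) := hK.comp_clm Y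
  have h1 : gZero A₀ Q₀ K M₀ z * gZero A₀ Q₀ K M₀ z
      = (z⁻¹ * z⁻¹) • (S * S - S * (K * Y) - (K * Y) * S + (K * Y) * (K * Y)) := by
    rw [gZero_eq]
    simp only [add_mul, mul_add, neg_mul, mul_neg, smul_mul_smul_comm, smul_sub, smul_add]
    abel
  rw [h1]
  have h2 : IsCompactOperator (S * S - S * (K * Y) - (K * Y) * S + (K * Y) * (K * Y) : H₀ →L[ℂ] H₀) :=
    ((hSS.sub (hKY.clm_comp S)).sub (hKY.comp_clm S)).add (hKY.clm_comp (K * Y))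
  exact h2.smul _

theorem differentiableAt_gZero (hA₀ : IsSelfAdjoint A₀) {z : ℂ} (hz : z.im ≠ 0) :
    DifferentiableAt ℂ (gZero A₀ Q₀ K M₀) z := by
  have hz0 : z ≠ 0 := fun h => hz (by simp [h])
  have h1 : DifferentiableAt ℂ (fun z => Q₀ * resolventAt A₀ z * star Q₀) z :=
    (((hasDerivAt_resolventAt hA₀ hz).const_mul Q₀).mul_const (star Q₀)).differentiableAt
  have h2 : DifferentiableAt ℂ (fun z : ℂ => z⁻¹) z := differentiableAt_inv hz0
  exact (h2.smul_const (star M₀)).neg.add (h2.smul (h1.const_mul K))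

theorem holderNear_gZero {s : ℤˣ} {γ : ℝ} (hγ : 0 < γ) (hγ' : γ ≤ 1) {x : ℝ} (hx : x ≠ 0)
    (hY : HolderNear (fun z => Q₀ * resolventAt A₀ z * star Q₀) (halfPlane s) γ x) :
    HolderNear (gZero A₀ Q₀ K M₀) (halfPlane s) γ x := by
  have := neBot_nhdsWithin_halfPlane_ofReal s x
  have hid : HolderNear (fun z : ℂ => z) (halfPlane s) γ x :=
    holderNear_of_lipschitz (r := 1) (C := 1) hγ' one_pos fun z _ w _ => by rw [one_mul]
  obtain ⟨Y₀, hY₀⟩ := hY.exists_tendsto hγ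
  have hidt : Tendsto (fun z : ℂ => z) (𝓝[halfPlane s] (x : ℂ)) (𝓝 (x : ℂ)) := inf_le_left
  let Ψ : ℂ × (H₀ →L[ℂ] H₀) → H₀ →L[ℂ] H₀ := fun p => -(p.1⁻¹ • star M₀) + p.1⁻¹ • (K * p.2)
  have hΨ : ContDiffAt ℂ 1 Ψ ((x : ℂ), Y₀) := by
    have hx' : ((x : ℂ), Y₀).1 ≠ 0 := Complex.ofReal_ne_zero.2 hx
    have h1 : ContDiffAt ℂ 1 (fun p : ℂ × (H₀ →L[ℂ] H₀) => p.1⁻¹) ((x : ℂ), Y₀) :=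
      contDiffAt_fst.inv hx'
    exact (h1.smul contDiffAt_const).neg.add (h1.smul (contDiffAt_const.mul contDiffAt_snd))
  exact (hid.prodMk hY).comp_contDiffAt (hidt.prodMk_nhds hY₀) hΨ

/-- `(A₀ + T - z) R₀(z) Q₀^* = Q₀^* (1 + G₀(z))`. -/
theorem add_sub_resolventAt_adjoint_apply (hA₀ : IsSelfAdjoint A₀)
    (hTA₀ : T ∘L A₀ = ContinuousLinearMap.adjoint Q₀ ∘L K ∘L Q₀)
    (hM₀ : M₀ ∘L Q₀ = Q₀ ∘L ContinuousLinearMap.adjoint T) {z : ℂ} (hz : z.im ≠ 0) (g : H₀) :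
    A₀ (resolventAt A₀ z (star Q₀ g)) + T (resolventAt A₀ z (star Q₀ g))
      - z • resolventAt A₀ z (star Q₀ g) = star Q₀ (g + gZero A₀ Q₀ K M₀ z g) := by
  have hz0 : z ≠ 0 := fun h => hz (by simp [h])
  set f := resolventAt A₀ z (star Q₀ g) with hf
  have h1 : A₀ f - z • f = star Q₀ g := sub_resolventAt_apply hA₀ hz _
  have h2 : T (A₀ f) = star Q₀ (K (Q₀ f)) := congrArg (fun B : H₀ →L[ℂ] H₀ => B f) hTA₀
  have h3 : T (star Q₀ g) = star Q₀ (star M₀ g) := by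
    have h4 := congrArg ContinuousLinearMap.adjoint hM₀
    rw [ContinuousLinearMap.adjoint_comp, ContinuousLinearMap.adjoint_comp,
      ContinuousLinearMap.adjoint_adjoint] at h4
    exact (congrArg (fun B : H₀ →L[ℂ] H₀ => B g) h4).symm
  -- Only `T A₀` and `T Q₀^* = Q₀^* M₀^*` factor through `Q₀^*`; `z f = A₀ f - Q₀^* g` expresses `z
  -- T f` by these two, whence the factor `z⁻¹` in `G₀`.
  have h5 : z • T f = star Q₀ (K (Q₀ f)) - star Q₀ (star M₀ g) := by
    rw [← h2, ← h3, ← h1, map_sub, map_smul]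
    abel
  have h6 : z • gZero A₀ Q₀ K M₀ z g = K (Q₀ f) - star M₀ g := by
    rw [gZero_eq]
    simp only [add_apply, neg_apply, smul_apply, mul_apply_eq_comp, smul_add, smul_neg, smul_smul,
      mul_inv_cancel₀ hz0, one_smul]
    rw [← hf]
    abel
  have h7 : T f = star Q₀ (gZero A₀ Q₀ K M₀ z g) := by
    have h8 : z • T f = z • star Q₀ (gZero A₀ Q₀ K M₀ z g) := by
      rw [h5, ← map_smul, h6, map_sub]
    exact (smul_right_injective H₀ hz0) h8
  rw [map_add, ← h7, ← h1]
  abel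

/-- The intertwining `J (A₀ + T - z) = (A - z) J` is applied to `f = R₀(z) Q₀^* g`. -/
theorem resolventAt_apply_adjoint_add_gZero (hA₀ : IsSelfAdjoint A₀) (hA : IsSelfAdjoint A)
    (hJT : A ∘L J - J ∘L A₀ = J ∘L T)
    (hTA₀ : T ∘L A₀ = ContinuousLinearMap.adjoint Q₀ ∘L K ∘L Q₀)
    (hM₀ : M₀ ∘L Q₀ = Q₀ ∘L ContinuousLinearMap.adjoint T) {z : ℂ} (hz : z.im ≠ 0) (g : H₀) :
    resolventAt A z (J (star Q₀ (g + gZero A₀ Q₀ K M₀ z g)))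
      = J (resolventAt A₀ z (star Q₀ g)) := by
  rw [← add_sub_resolventAt_adjoint_apply hA₀ hTA₀ hM₀ hz]
  set f := resolventAt A₀ z (star Q₀ g)
  have h1 : A (J f) - J (A₀ f) = J (T f) := congrArg (fun B : H₀ →L[ℂ] H => B f) hJT
  have h2 : J (A₀ f + T f - z • f) = A (J f) - z • J f := by
    rw [map_sub, map_add, map_smul, ← h1]
    abel
  rw [h2, resolventAt_sub_apply hA hz]

theorem eq_zero_of_add_gZero_eq_zero (hA₀ : IsSelfAdjoint A₀) (hA : IsSelfAdjoint A)
    (hJT : A ∘L J - J ∘L A₀ = J ∘L T)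
    (hii : ∀ z : ℂ, z ≠ 0 → ∀ f : H₀, J f = 0 → A₀ f + T f - z • f = 0 → f = 0)
    (hQ₀' : ∀ f : H₀, ContinuousLinearMap.adjoint Q₀ f = 0 → f = 0)
    (hTA₀ : T ∘L A₀ = ContinuousLinearMap.adjoint Q₀ ∘L K ∘L Q₀)
    (hM₀ : M₀ ∘L Q₀ = Q₀ ∘L ContinuousLinearMap.adjoint T) {z : ℂ} (hz : z.im ≠ 0) {g : H₀}
    (hg : g + gZero A₀ Q₀ K M₀ z g = 0) : g = 0 := by
  have hz0 : z ≠ 0 := fun h => hz (by simp [h])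
  have h1 := resolventAt_apply_adjoint_add_gZero hA₀ hA hJT hTA₀ hM₀ hz g
  have h2 := add_sub_resolventAt_adjoint_apply hA₀ hTA₀ hM₀ hz g
  rw [hg, map_zero] at h1 h2
  rw [map_zero, map_zero] at h1
  have h3 := hii z hz0 _ h1.symm h2
  have h4 := sub_resolventAt_apply hA₀ hz (star Q₀ g)
  rw [h3, map_zero, smul_zero, sub_zero] at h4
  exact hQ₀' g h4.symm

theorem sandwich_mul_one_add_gZero {M : H₀ →L[ℂ] H₀} (hA₀ : IsSelfAdjoint A₀) (hA : IsSelfAdjoint A)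
    (hJT : A ∘L J - J ∘L A₀ = J ∘L T)
    (hTA₀ : T ∘L A₀ = ContinuousLinearMap.adjoint Q₀ ∘L K ∘L Q₀)
    (hM₀ : M₀ ∘L Q₀ = Q₀ ∘L ContinuousLinearMap.adjoint T)
    (hM : M ∘L Q₀ = Q₀ ∘L ContinuousLinearMap.adjoint J ∘L J) {z : ℂ} (hz : z.im ≠ 0) :
    sandwich A (Q₀ ∘L ContinuousLinearMap.adjoint J) z * (1 + gZero A₀ Q₀ K M₀ z)
      = M * (Q₀ * resolventAt A₀ z * star Q₀) := by
  ext g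
  have h1 := resolventAt_apply_adjoint_add_gZero hA₀ hA hJT hTA₀ hM₀ hz g
  have h2 : M (Q₀ (resolventAt A₀ z (star Q₀ g)))
      = Q₀ (ContinuousLinearMap.adjoint J (J (resolventAt A₀ z (star Q₀ g)))) :=
    congrArg (fun B : H₀ →L[ℂ] H₀ => B (resolventAt A₀ z (star Q₀ g))) hM
  have h3 : (M * (Q₀ * resolventAt A₀ z * star Q₀)) g = M (Q₀ (resolventAt A₀ z (star Q₀ g))) := rfl
  rw [h3, h2, ← h1, sandwich, ContinuousLinearMap.adjoint_comp, ContinuousLinearMap.adjoint_adjoint]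
  rfl

/-- Off the axis `Q R Q^* = M Y (1 + G₀)⁻¹` with `Y = Q₀ R₀ Q₀^*`. At a non-exceptional point this
is a `C¹` function of the pair `(Y, G₀)` near its boundary value. -/
theorem holderNear_sandwich_of_notMem {M : H₀ →L[ℂ] H₀} (hA₀ : IsSelfAdjoint A₀)
    (hA : IsSelfAdjoint A) (hJT : A ∘L J - J ∘L A₀ = J ∘L T)
    (hii : ∀ z : ℂ, z ≠ 0 → ∀ f : H₀, J f = 0 → A₀ f + T f - z • f = 0 → f = 0)
    (hQ₀' : ∀ f : H₀, ContinuousLinearMap.adjoint Q₀ f = 0 → f = 0)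
    (hK : IsCompactOperator K)
    (hTA₀ : T ∘L A₀ = ContinuousLinearMap.adjoint Q₀ ∘L K ∘L Q₀)
    (hM₀ : M₀ ∘L Q₀ = Q₀ ∘L ContinuousLinearMap.adjoint T)
    (hM₀' : IsCompactOperator (M₀ ∘L M₀))
    (hM : M ∘L Q₀ = Q₀ ∘L ContinuousLinearMap.adjoint J ∘L J)
    {s : ℤˣ} {γ : ℝ} (hγ : 0 < γ) (hγ' : γ ≤ 1) {Δ : Set ℝ} {x : ℝ} (hx : x ∈ Δ) (hx0 : x ≠ 0)
    (hY : HolderNear (fun z => Q₀ * resolventAt A₀ z * star Q₀) (halfPlane s) γ x)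
    (hxN : x ∉ exceptionalSet (gZero A₀ Q₀ K M₀) Δ s) :
    HolderNear (sandwich A (Q₀ ∘L ContinuousLinearMap.adjoint J)) (halfPlane s) γ x := by
  have := neBot_nhdsWithin_halfPlane_ofReal s x
  have hG := holderNear_gZero (K := K) (M₀ := M₀) hγ hγ' hx0 hY
  obtain ⟨Y₀, hY₀⟩ := hY.exists_tendsto hγ
  obtain ⟨B₀, hB₀⟩ := hG.exists_tendsto hγ
  obtain ⟨v, hv⟩ := isUnit_one_add_of_notMem_exceptionalSet
    (fun z _ => isCompactOperator_gZero_sq hK hM₀' z) hB₀ hx hxN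
  let Ψ : (H₀ →L[ℂ] H₀) × (H₀ →L[ℂ] H₀) → H₀ →L[ℂ] H₀ := fun p => M * p.1 * Ring.inverse (1 + p.2)
  have hΨ : ContDiffAt ℂ 1 Ψ (Y₀, B₀) := by
    have h1 : ContDiffAt ℂ 1 (fun p : (H₀ →L[ℂ] H₀) × (H₀ →L[ℂ] H₀) => Ring.inverse (1 + p.2))
        (Y₀, B₀) := by
      refine ContDiffAt.comp (Y₀, B₀) (g := Ring.inverse)
        (f := fun p : (H₀ →L[ℂ] H₀) × (H₀ →L[ℂ] H₀) => 1 + p.2) ?_ (contDiffAt_const.add contDiffAt_snd)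
      change ContDiffAt ℂ 1 Ring.inverse (1 + B₀)
      rw [← hv]
      exact contDiffAt_ringInverse ℂ v
    exact (contDiffAt_const.mul contDiffAt_fst).mul h1
  refine ((hY.prodMk hG).comp_contDiffAt (hY₀.prodMk_nhds hB₀) hΨ).congr fun z hz => ?_
  have hz0 : z.im ≠ 0 := fun h0 => by
    have : 0 < ((s : ℤ) : ℝ) * z.im := hz
    simp [h0] at this
  have hu : IsUnit (1 + gZero A₀ Q₀ K M₀ z) :=
    isUnit_one_add_of_isCompactOperator_sq (isCompactOperator_gZero_sq hK hM₀' z)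
      fun g hg => eq_zero_of_add_gZero_eq_zero hA₀ hA hJT hii hQ₀' hTA₀ hM₀ hz0 hg
  simp only [Ψ]
  rw [← sandwich_mul_one_add_gZero hA₀ hA hJT hTA₀ hM₀ hM hz0, mul_assoc,
    Ring.mul_inverse_cancel _ hu, mul_one]

end ResolventIdentity

/-! ### Conclusion -/

theorem mainTheorem5
    {H₀ H h : Type*}
    [NormedAddCommGroup H₀] [InnerProductSpace ℂ H₀] [CompleteSpace H₀]
    [NormedAddCommGroup H] [InnerProductSpace ℂ H] [CompleteSpace H]
    [NormedAddCommGroup h] [InnerProductSpace ℂ h] [CompleteSpace h]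
    -- the self-adjoint operators, the identification and the factorisation `A J - J A₀ = J T`
    (A₀ : H₀ →L[ℂ] H₀) (hA₀ : IsSelfAdjoint A₀)
    (A : H →L[ℂ] H) (hA : IsSelfAdjoint A)
    (J : H₀ →L[ℂ] H) (T : H₀ →L[ℂ] H₀)
    (hJT : A ∘L J - J ∘L A₀ = J ∘L T)
    -- the interval `Δ = (a, b)`
    (a b : ℝ) (h0 : (0 : ℝ) ∉ Ioo a b)
    (Q₀ : H₀ →L[ℂ] H₀)
    -- (ii)
    (hii : ∀ z : ℂ, z ≠ 0 → ∀ f : H₀, J f = 0 → A₀ f + T f - z • f = 0 → f = 0)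
    -- (iii)
    (hQ₀ : ∀ f : H₀, Q₀ f = 0 → f = 0)
    (hQ₀' : ∀ f : H₀, ContinuousLinearMap.adjoint Q₀ f = 0 → f = 0)
    -- (iv)
    (γ : ℝ) (hγ : 1 / 2 < γ) (hγ' : γ < 1)
    (hsmooth : StronglySmooth h A₀ Q₀ (Ioo a b) γ)
    -- (v)
    (K : H₀ →L[ℂ] H₀) (hK : IsCompactOperator K)
    (hTA₀ : T ∘L A₀ = ContinuousLinearMap.adjoint Q₀ ∘L K ∘L Q₀)
    -- (vi) `M₀` is the bounded extension of `Q₀ T^* Q₀⁻¹` from the dense set `Ran Q₀`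
    (M₀ : H₀ →L[ℂ] H₀) (hM₀ : M₀ ∘L Q₀ = Q₀ ∘L ContinuousLinearMap.adjoint T)
    (hM₀' : IsCompactOperator (M₀ ∘L M₀))
    -- (vii) `M` is the bounded extension of `Q₀ J^* J Q₀⁻¹` from the dense set `Ran Q₀`
    (M : H₀ →L[ℂ] H₀) (hM : M ∘L Q₀ = Q₀ ∘L ContinuousLinearMap.adjoint J ∘L J) :
    -- the boundary values `G₀(x ± i0)` exist on `Δ`
    (∀ s : ℤˣ, ∀ x ∈ Ioo a b, ∃ B : H₀ →L[ℂ] H₀,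
      IsBoundaryValue (gZero A₀ Q₀ K M₀) s x B) ∧
    -- the sets `N₊`, `N₋` are closed in `Δ` and of measure zero
    (∀ s : ℤˣ,
      (∃ S : Set ℝ, IsClosed S ∧
        exceptionalSet (gZero A₀ Q₀ K M₀) (Ioo a b) s = S ∩ Ioo a b) ∧
      volume (exceptionalSet (gZero A₀ Q₀ K M₀) (Ioo a b) s) = 0) ∧
    -- `Q R(z) Q^*`, where `Q = Q₀ J^*`, is Hölder continuous up to the cut away from `N = N₊ ∩ N₋`
    (∀ s : ℤˣ, ∃ B : ℂ → H₀ →L[ℂ] H₀,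
      (∀ z ∈ halfPlane s,
        B z = (Q₀ ∘L ContinuousLinearMap.adjoint J) ∘L resolventAt A z ∘L
          ContinuousLinearMap.adjoint (Q₀ ∘L ContinuousLinearMap.adjoint J)) ∧
      ∀ δ : Set ℝ, IsCompact δ →
        δ ⊆ Ioo a b \ (exceptionalSet (gZero A₀ Q₀ K M₀) (Ioo a b) 1 ∩
          exceptionalSet (gZero A₀ Q₀ K M₀) (Ioo a b) (-1)) →
        ∃ C : ℝ, ∀ z w : ℂ, z.re ∈ δ → w.re ∈ δ →
          0 ≤ ((s : ℤ) : ℝ) * z.im → 0 ≤ ((s : ℤ) : ℝ) * w.im →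
          ‖B z - B w‖ ≤ C * ‖z - w‖ ^ γ) := by

  have hγ0 : 0 < γ := by linarith
  have hne0 : ∀ x ∈ Ioo a b, x ≠ 0 := fun x hx h => h0 (h ▸ hx)
  have hY : ∀ s : ℤˣ, ∀ x ∈ Ioo a b,
      HolderNear (fun z => Q₀ * resolventAt A₀ z * star Q₀) (halfPlane s) γ x := fun s x hx =>
    hsmooth.holderNear hA₀ hγ0 hγ' hx s
  have hG : ∀ s : ℤˣ, ∀ x ∈ Ioo a b, HolderNear (gZero A₀ Q₀ K M₀) (halfPlane s) γ x :=
    fun s x hx => holderNear_gZero hγ0 hγ'.le (hne0 x hx) (hY s x hx)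
  have hlim : ∀ s : ℤˣ, ∀ x ∈ Ioo a b, ∃ B : H₀ →L[ℂ] H₀,
      IsBoundaryValue (gZero A₀ Q₀ K M₀) s x B := fun s x hx =>
    have := neBot_nhdsWithin_halfPlane_ofReal s x
    (hG s x hx).exists_tendsto hγ0
  have hcomp : ∀ z, IsCompactOperator (gZero A₀ Q₀ K M₀ z * gZero A₀ Q₀ K M₀ z : H₀ →L[ℂ] H₀) :=
    fun z => isCompactOperator_gZero_sq hK hM₀' z
  have him : ∀ (s : ℤˣ), ∀ z ∈ halfPlane s, z.im ≠ 0 := fun s z hz h => by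
    have h1 : 0 < ((s : ℤ) : ℝ) * z.im := hz
    simp [h] at h1
  refine ⟨hlim, fun s => ⟨exists_isClosed_exceptionalSet_eq (fun z _ => hcomp z) (hlim s), ?_⟩,
    fun s => ?_⟩
  · exact volume_exceptionalSet_eq_zero isOpen_Ioo hγ0 (fun z _ => hcomp z)
      (fun z hz => differentiableAt_gZero hA₀ (him s z hz))
      (fun z hz g hg => eq_zero_of_add_gZero_eq_zero hA₀ hA hJT hii hQ₀' hTA₀ hM₀ (him s z hz) hg)
      (hG s)
  · refine ⟨boundaryExtension (sandwich A (Q₀ ∘L ContinuousLinearMap.adjoint J)) (halfPlane s),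
      fun z hz => if_pos hz, fun δ hδ hδN =>
        exists_norm_boundaryExtension_sub_le hA hγ0 hγ'.le hδ fun x hx => ?_⟩
    have hxΔ := (hδN hx).1
    have hone : ∀ t : ℤˣ, x ∉ exceptionalSet (gZero A₀ Q₀ K M₀) (Ioo a b) t →
        HolderNear (sandwich A (Q₀ ∘L ContinuousLinearMap.adjoint J)) (halfPlane t) γ x := fun t ht =>
      holderNear_sandwich_of_notMem hA₀ hA hJT hii hQ₀' hK hTA₀ hM₀ hM₀' hM hγ0 hγ'.le hxΔ
        (hne0 x hxΔ) (hY t x hxΔ) ht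
    -- Outside the intersection at least one side `t` is regular; if it is not the side `s` under
    -- consideration, taking adjoints transfers the bound across the cut.
    obtain ⟨t, ht⟩ : ∃ t : ℤˣ, x ∉ exceptionalSet (gZero A₀ Q₀ K M₀) (Ioo a b) t := by
      by_contra hcon
      push Not at hcon
      exact (hδN hx).2 ⟨hcon 1, hcon (-1)⟩
    have hst : s = t ∨ s = -t := by
      rcases Int.units_eq_one_or s with rfl | rfl <;> rcases Int.units_eq_one_or t with rfl | rfl <;>
        simp
    rcases hst with rfl | rfl
    · exact hone s ht
    · refine (hone t ht).star_conj fun z _ => ?_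
      rw [star_sandwich hA, star_star]
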